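/- Let $m>1$, let $X\subset\mathbb{R}^m$ be a bounded, connected, nonempty open set and $Y=(a,b)\subset\mathbb{R}$ a bounded open interval. Let $c\in C^2(\bar X\times\bar Y)$ be such that $y\mapsto D_xc(x,y)$ is injective on $Y$ for each $x\in X$, and $D^2_{xy}c(x,y)\neq 0$ for all $(x,y)\in X\times Y$. Let $M_c\ge 0$ be a Lipschitz constant on $\bar X$ of $x\mapsto c(x,y)$, for all $y\in\bar Y$. Let $\nu$ be a probability measure with $d\nu=\bar\nu(y)\,dy$ on $Y$, where $\bar\nu\geq 0$ is a fixed density. Let $g:[0,\infty)\to\mathbb{R}$ be strictly convex, continuously differentiable on $(0,\infty)$, with $g(t)/t\to+\infty$ as $t\to\infty$ and $g'(t)\to-\infty$ as $t\to0^+$. For $\mu\in P(\bar X)$ put $\mathcal T_c(\mu,\nu)=\inf_{\gamma\in\Pi(\mu,\nu)}\int c\,d\gamma$, where $\Pi(\mu,\nu)$ is the set of couplings of $\mu$ and $\nu$, and $\mathcal G(\mu)=\int_X g(\bar\mu(x))\,dx$ if $\mu$ has a density $\bar\mu$ with respect to Lebesgue measure on $X$, and $\mathcal G(\mu)=+\infty$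 otherwise. Let $\mu$ minimize $\mathcal T_c(\cdot,\nu)+\mathcal G$ over $P(\bar X)$. For $y\in Y$ and $k\in\mathbb{R}$ let $X_\ge(y,k)=\{x\in X:\partial_yc(x,y)\ge k\}$ and $X_>(y,k)=\{x\in X:\partial_yc(x,y)>k\}$, and let $k(y)$ denote a number with $\mu(X_\ge(y,k(y)))=\nu((-\infty,y])$. For $y_0<y_1$ in $Y$ and $k_0\in\partial_yc(X,y_0)$ let $$k_{max}(y_0,y_1,k_0)=\sup\{k: X_\ge(y_0,k_0)\subseteq X_\ge(y_1,k)\},\qquad S(y_0,y_1,k_0)=X_\ge(y_1,k_{max}(y_0,y_1,k_0))\setminus X_\ge(y_0,k_0),$$ and let $D^{min}_{vol}(y_0,y_1,k_0)$ be the Lebesgue measure of $S(y_0,y_1,k_0)$. Let $(g')^{-1}:\mathbb{R}\to(0,\infty)$ be the inverse of $g'$ and, for bounded measurable $w:X\to\mathbb{R}$, let $K_w:(0,\infty)\to\mathbb{R}$ be the inverse of $z\mapsto\int_X(g')^{-1}(z-w(x))\,dx$. Assume that for all $y_0<y<y_1$ in $Y$ such that $k(y_0)\in\partial_yc(X,y_0)$,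 and all $x\in S(y_0,y_1,k(y_0))$, $$(g')^{-1}\big(K_{M_c|\cdot|}(1)+M_c|x|\big)<\frac{\bar\nu(y)(y_1-y_0)}{D^{min}_{vol}(y_0,y_1,k(y_0))}.$$ Then $(c,\mu,\nu)$ is nested: for every $y\in Y$ a level $k(y)$ exists, and for all $y_0<y_1$ in $Y$ with $\nu([y_0,y_1])>0$ and every choice of the levels, $X_\ge(y_0,k(y_0))\subseteq X_>(y_1,k(y_1))$. -/

import Mathlib

open MeasureTheory Set Filter Topology

noncomputable section

namespace Congestion

variable {m : ℕ}

/-- The transport cost `T_c(μ, ν)`: the infimum of `∫ c dγ` over all couplings `γ` of `μ` and `ν`. -/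
def transportCost (c : EuclideanSpace ℝ (Fin m) → ℝ → ℝ)
    (μ : Measure (EuclideanSpace ℝ (Fin m))) (ν : Measure ℝ) : ℝ :=
  sInf {r : ℝ | ∃ γ : Measure (EuclideanSpace ℝ (Fin m) × ℝ), IsProbabilityMeasure γ ∧
    γ.map Prod.fst = μ ∧ γ.map Prod.snd = ν ∧ r = ∫ p, c p.1 p.2 ∂γ}

/-- Standing assumptions on the cost: it is `C²` up to the boundary, twisted and non-degenerate
(for a one-dimensional target the mixed second derivative is a vector, and full rank means
that it does not vanish). -/
structure IsAdmissibleCost (X : Set (EuclideanSpace ℝ (Fin m))) (Y : Set ℝ)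
    (c : EuclideanSpace ℝ (Fin m) → ℝ → ℝ) : Prop where
  smooth : ContDiffOn ℝ 2 (fun p : EuclideanSpace ℝ (Fin m) × ℝ => c p.1 p.2)
    (closure X ×ˢ closure Y)
  twist : ∀ x ∈ X, InjOn (fun y => fderiv ℝ (fun z => c z y) x) Y
  nondegenerate : ∀ x ∈ X, ∀ y ∈ Y, fderiv ℝ (fun z => deriv (fun t => c z t) y) x ≠ 0

/-- Conditions on the integrand of a congestion functional. Only its values on `[0, ∞)` matter. -/
structure IsCongestionIntegrand (g : ℝ → ℝ) : Prop where
  contDiffOn : ContDiffOn ℝ 1 g (Ioi 0)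
  strictConvexOn : StrictConvexOn ℝ (Ici 0) g
  superlinear : Tendsto (fun t => g t / t) atTop atTop
  deriv_zero : Tendsto (deriv g) (𝓝[>] 0) atBot

open Classical in
/-- The congestion functional `G(μ) = ∫_X g(μ̄(x)) dx`, where `μ̄` is the density of `μ` with respect
to Lebesgue measure on `X`; it is `+∞` if `μ` has no such density. Under the conditions on `g` the
integrand is bounded below, so for bounded `X` it fails to be integrable only if its integral
is `+∞`. -/
def congestion (X : Set (EuclideanSpace ℝ (Fin m))) (g : ℝ → ℝ)
    (μ : Measure (EuclideanSpace ℝ (Fin m))) : EReal :=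
  if μ ≪ volume.restrict X ∧ IntegrableOn (fun x => g (μ.rnDeriv volume x).toReal) X then
    ((∫ x in X, g (μ.rnDeriv volume x).toReal : ℝ) : EReal)
  else ⊤

/-- `μ` minimizes `T_c(·, ν) + G` among the probability measures on the closure of `X`. -/
def IsMinimizer (X : Set (EuclideanSpace ℝ (Fin m))) (c : EuclideanSpace ℝ (Fin m) → ℝ → ℝ)
    (g : ℝ → ℝ) (ν : Measure ℝ) (μ : Measure (EuclideanSpace ℝ (Fin m))) : Prop :=
  (IsProbabilityMeasure μ ∧ μ (closure X)ᶜ = 0) ∧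
    ∀ μ' : Measure (EuclideanSpace ℝ (Fin m)), IsProbabilityMeasure μ' → μ' (closure X)ᶜ = 0 →
      (transportCost c μ ν : EReal) + congestion X g μ ≤
        (transportCost c μ' ν : EReal) + congestion X g μ'

/-- `X_≥(y, k)`. -/
def superLevel (X : Set (EuclideanSpace ℝ (Fin m))) (c : EuclideanSpace ℝ (Fin m) → ℝ → ℝ)
    (y k : ℝ) : Set (EuclideanSpace ℝ (Fin m)) :=
  {x ∈ X | k ≤ deriv (fun t => c x t) y}

/-- `X_>(y, k)`. -/
def strictSuperLevel (X : Set (EuclideanSpace ℝ (Fin m)))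
    (c : EuclideanSpace ℝ (Fin m) → ℝ → ℝ) (y k : ℝ) : Set (EuclideanSpace ℝ (Fin m)) :=
  {x ∈ X | k < deriv (fun t => c x t) y}

/-- The level `k` is an admissible value of `k(y)`: it splits the mass proportionately with `y`. -/
def IsSplittingLevel (X : Set (EuclideanSpace ℝ (Fin m)))
    (c : EuclideanSpace ℝ (Fin m) → ℝ → ℝ) (μ : Measure (EuclideanSpace ℝ (Fin m)))
    (ν : Measure ℝ) (y k : ℝ) : Prop :=
  μ (superLevel X c y k) = ν (Iic y)

/-- The model `(c, μ, ν)` is nested: the splitting levels `k(y)` exist, and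
`X_≥(y₀, k(y₀)) ⊆ X_>(y₁, k(y₁))` whenever `y₀ < y₁` and `ν([y₀, y₁]) > 0`. -/
def IsNested (X : Set (EuclideanSpace ℝ (Fin m))) (Y : Set ℝ)
    (c : EuclideanSpace ℝ (Fin m) → ℝ → ℝ) (μ : Measure (EuclideanSpace ℝ (Fin m)))
    (ν : Measure ℝ) : Prop :=
  (∀ y ∈ Y, ∃ k, IsSplittingLevel X c μ ν y k) ∧
    ∀ y₀ ∈ Y, ∀ y₁ ∈ Y, y₀ < y₁ → 0 < ν (Icc y₀ y₁) →
      ∀ k₀ k₁, IsSplittingLevel X c μ ν y₀ k₀ → IsSplittingLevel X c μ ν y₁ k₁ →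
        superLevel X c y₀ k₀ ⊆ strictSuperLevel X c y₁ k₁

/-- `k_max(y₀, y₁, k₀)`, for `k₀` in the range of `x ↦ ∂c/∂y (x, y₀)` on `X`. -/
def kMax (X : Set (EuclideanSpace ℝ (Fin m))) (c : EuclideanSpace ℝ (Fin m) → ℝ → ℝ)
    (y₀ y₁ k₀ : ℝ) : ℝ :=
  sSup {k : ℝ | superLevel X c y₀ k₀ ⊆ superLevel X c y₁ k}

/-- The region `X_≥(y₁, k_max(y₀, y₁, k₀)) \ X_≥(y₀, k₀)`. -/
def minRegion (X : Set (EuclideanSpace ℝ (Fin m))) (c : EuclideanSpace ℝ (Fin m) → ℝ → ℝ)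
    (y₀ y₁ k₀ : ℝ) : Set (EuclideanSpace ℝ (Fin m)) :=
  superLevel X c y₁ (kMax X c y₀ y₁ k₀) \ superLevel X c y₀ k₀

/-- The minimal mass difference `D^min_ρ(y₀, y₁, k₀)` with respect to a measure `ρ`. -/
def minMassDiff (X : Set (EuclideanSpace ℝ (Fin m))) (c : EuclideanSpace ℝ (Fin m) → ℝ → ℝ)
    (ρ : Measure (EuclideanSpace ℝ (Fin m))) (y₀ y₁ k₀ : ℝ) : ℝ :=
  (ρ (minRegion X c y₀ y₁ k₀)).toReal

/-- `(g')⁻¹`, the inverse of the bijection `g' : (0, ∞) → ℝ`. -/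
def derivInv (g : ℝ → ℝ) : ℝ → ℝ :=
  Function.invFunOn (deriv g) (Ioi 0)

/-- `K_w`, the inverse of the bijection `z ↦ ∫_X (g')⁻¹(z - w(x)) dx` from `ℝ` to `(0, ∞)`. -/
def massInv (X : Set (EuclideanSpace ℝ (Fin m))) (g : ℝ → ℝ)
    (w : EuclideanSpace ℝ (Fin m) → ℝ) : ℝ → ℝ :=
  Function.invFun (fun z : ℝ => ∫ x in X, derivInv g (z - w x))

/-- The explicit bound `(g')⁻¹(K_{M|·|}(1) + M|x|)`. -/
def densityBound (X : Set (EuclideanSpace ℝ (Fin m))) (g : ℝ → ℝ) (M : ℝ)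
    (x : EuclideanSpace ℝ (Fin m)) : ℝ :=
  derivInv g (massInv X g (fun z => M * ‖z‖) 1 + M * ‖x‖)

end Congestion

end

/-! The plan is to bound the density `r` of the minimizer `μ` almost everywhere by `densityBound`,
and to turn this bound into a comparison of masses.

Heuristically `g'(r) = C - φ` for a Kantorovich potential `φ`. Since `φ` is `M`-Lipschitz it can be
normalized to `|φ| ≤ M‖x‖`. Unit mass then forces `C ≤ K` with `K = massInv X g (M‖·‖) 1`, so `g'(r)
≤ K + M‖x‖`. No potentials are used below. Suppose `r` exceeds the bound on a set of positive
measure. Both `r` and `derivInv g (K - M‖x‖)` have integral 1 over `X`, so `r` is at most the latter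
on another set of positive measure. Moving a little mass from part of the first set to part of the
second costs at most `M(‖x‖ + ‖x'‖)` per unit of transported mass (`transportCost_redistribute_le`),
and the drop in congestion outweighs this. `first_order_condition` states the balance;
`density_le_densityBound` draws the contradiction.

Let `S` be the region `minRegion X c y₀ y₁ k₀`. Integrating the bound over `S` gives `μ S < νbar y *
(y₁ - y₀)` for each `y` in between, and integrating over `y` gives `μ S < ν (Icc y₀ y₁)`. So the
superlevel set at `kMax` has less mass than `ν (Iic y₁)`, whence `k₁ < kMax`, and this is nestedness
(`superLevel_subset_strictSuperLevel`). Levels exist because the level sets of `∂c/∂y` are null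
(`volume_level_eq_zero`, `exists_level`). -/

namespace Congestion

variable {m : ℕ}

/-! ### Convex analysis of the integrand and the inverse of its derivative. -/

namespace IsCongestionIntegrand

variable {g : ℝ → ℝ} (hg : IsCongestionIntegrand g)
include hg

theorem differentiableAt {t : ℝ} (ht : 0 < t) : DifferentiableAt ℝ g t :=
  ((hg.contDiffOn.differentiableOn one_ne_zero) t ht).differentiableAt (Ioi_mem_nhds ht)

theorem continuousOn_deriv : ContinuousOn (deriv g) (Ioi 0) :=
  hg.contDiffOn.continuousOn_deriv_of_isOpen isOpen_Ioi le_rfl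

theorem strictMonoOn_deriv : StrictMonoOn (deriv g) (Ioi 0) :=
  (hg.strictConvexOn.subset Ioi_subset_Ici_self (convex_Ioi 0)).strictMonoOn_deriv
    fun _ hx => hg.differentiableAt hx

/-- The tangent line inequality. -/
theorem tangent_le {p r : ℝ} (hp : 0 < p) (hr : 0 ≤ r) :
    g p + deriv g p * (r - p) ≤ g r := by
  have hd := hg.differentiableAt hp
  have hcv := hg.strictConvexOn.convexOn
  rcases lt_trichotomy p r with h | rfl | h
  · have := hcv.deriv_le_slope (mem_Ici.2 hp.le) (mem_Ici.2 hr) h hd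
    rw [slope_def_field, le_div_iff₀ (by linarith)] at this
    linarith
  · simp
  · have := hcv.slope_le_deriv (mem_Ici.2 hr) (mem_Ici.2 hp.le) h hd
    rw [slope_def_field, div_le_iff₀ (by linarith)] at this
    linarith

/-- The tangent at `t`, evaluated at 0, gives `g'(t) ≥ (g t - g 0) / t`, which is unbounded by
superlinearity. As `g' → -∞` at 0, the intermediate value theorem does the rest. -/
theorem surjOn_deriv : SurjOn (deriv g) (Ioi 0) univ := by
  intro z _
  obtain ⟨s, hs, hs0⟩ : ∃ s, deriv g s ≤ z ∧ 0 < s :=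
    ((hg.deriv_zero.eventually (eventually_le_atBot z)).and self_mem_nhdsWithin).exists
  -- The surplus `|g 0|`, with `1 < t`, absorbs the term `g 0`.
  obtain ⟨t, ht, ht0⟩ : ∃ t, z + |g 0| ≤ g t / t ∧ 1 < t :=
    ((hg.superlinear.eventually (eventually_ge_atTop (z + |g 0|))).and
      (eventually_gt_atTop 1)).exists
  have htp : 0 < t := by linarith
  have hzt : z ≤ deriv g t := by
    have h1 := hg.tangent_le htp le_rfl
    rw [le_div_iff₀ htp] at ht
    have h2 : |g 0| ≤ |g 0| * t := le_mul_of_one_le_right (abs_nonneg _) ht0.le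
    have h3 := neg_abs_le (g 0)
    have h4 := le_abs_self (g 0)
    have : z * t ≤ deriv g t * t := by nlinarith
    exact le_of_mul_le_mul_right this htp
  exact isPreconnected_Ioi.intermediate_value (mem_Ioi.2 hs0) (mem_Ioi.2 htp)
    hg.continuousOn_deriv ⟨hs, hzt⟩

theorem derivInv_pos (z : ℝ) : 0 < derivInv g z :=
  Function.invFunOn_mem (hg.surjOn_deriv (mem_univ z))

theorem deriv_derivInv (z : ℝ) : deriv g (derivInv g z) = z :=
  Function.invFunOn_eq (hg.surjOn_deriv (mem_univ z))

theorem derivInv_deriv {t : ℝ} (ht : 0 < t) : derivInv g (deriv g t) = t :=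
  hg.strictMonoOn_deriv.injOn (hg.derivInv_pos _) ht (hg.deriv_derivInv _)

theorem strictMono_derivInv : StrictMono (derivInv g) := by
  intro z w h
  refine (hg.strictMonoOn_deriv.lt_iff_lt (hg.derivInv_pos z) (hg.derivInv_pos w)).1 ?_
  rwa [hg.deriv_derivInv, hg.deriv_derivInv]

theorem continuous_derivInv : Continuous (derivInv g) := by
  -- A monotone map onto an order-topological space is continuous; restricting the codomain makes
  -- the map onto.
  let F : ℝ → Ioi (0 : ℝ) := fun z => ⟨derivInv g z, hg.derivInv_pos z⟩
  have hF : Continuous F := by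
    refine Monotone.continuous_of_surjective (fun z w h => hg.strictMono_derivInv.monotone h) ?_
    exact fun t => ⟨deriv g t, Subtype.ext (hg.derivInv_deriv t.2)⟩
  exact continuous_subtype_val.comp hF

theorem le_deriv {z t : ℝ} (h : derivInv g z ≤ t) : z ≤ deriv g t := by
  rw [← hg.deriv_derivInv z]
  exact hg.strictMonoOn_deriv.monotoneOn (hg.derivInv_pos z)
    (mem_Ioi.2 ((hg.derivInv_pos z).trans_le h)) h

theorem deriv_le {z t : ℝ} (ht : 0 < t) (h : t ≤ derivInv g z) : deriv g t ≤ z := by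
  rw [← hg.deriv_derivInv z]
  exact hg.strictMonoOn_deriv.monotoneOn ht (hg.derivInv_pos z) h

/-- `g` agrees with a Borel function on `[0, ∞)`. -/
theorem measurable_comp {α : Type*} [MeasurableSpace α] {r : α → ℝ} (hr : Measurable r)
    (hr0 : ∀ x, 0 ≤ r x) : Measurable fun x => g (r x) := by
  classical
  -- Convexity allows a jump of `g` at 0, so this point is treated apart.
  have h1 : Measurable ((Ioi (0 : ℝ)).piecewise g fun _ => g 0) :=
    hg.contDiffOn.continuousOn.measurable_piecewise continuousOn_const measurableSet_Ioi
  convert h1.comp hr using 2 with x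
  rcases (hr0 x).eq_or_lt with h | h
  · simp [← h]
  · simp [piecewise, h]

variable {X : Set (EuclideanSpace ℝ (Fin m))} (hXo : IsOpen X) (hXb : Bornology.IsBounded X)
  (hXn : X.Nonempty) (M : NNReal)

omit hg in
theorem _root_.Congestion.integrableOn_of_continuous (hXb : Bornology.IsBounded X)
    {h : EuclideanSpace ℝ (Fin m) → ℝ} (hh : Continuous h) : IntegrableOn h X :=
  (hh.continuousOn.integrableOn_compact hXb.isCompact_closure).mono_set subset_closure

include hXo hXb hXn in
-- `Function.invFun` is meaningful only on the range, so 1 must be shown to be attained: the mass is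
-- continuous in `z` by dominated convergence and is compared with the uniform density `1 /
-- volume.real X`.
theorem massInv_spec :
    ∫ x in X, derivInv g (massInv X g (fun z => M * ‖z‖) 1 - M * ‖x‖) = 1 := by
  set F : ℝ → ℝ := fun z => ∫ x in X, derivInv g (z - M * ‖x‖) with hF
  have hf := hg.continuous_derivInv
  have hX : ∀ᵐ x ∂(volume.restrict X), x ∈ X := ae_restrict_mem hXo.measurableSet
  obtain ⟨R, hR0, hR⟩ := hXb.exists_pos_norm_le
  have hvol : 0 < volume.real X :=
    ENNReal.toReal_pos (hXo.measure_pos volume hXn).ne' hXb.measure_lt_top.ne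
  have hint (z : ℝ) : IntegrableOn (fun x => derivInv g (z - M * ‖x‖)) X :=
    integrableOn_of_continuous hXb (by fun_prop)
  have hcst (t : ℝ) : IntegrableOn (fun _ : EuclideanSpace ℝ (Fin m) => t) X :=
    integrableOn_of_continuous hXb continuous_const
  have hcont : Continuous F := by
    rw [continuous_iff_continuousAt]
    intro z
    refine continuousAt_of_dominated (bound := fun _ => derivInv g (z + 1)) ?_ ?_ (hcst _) ?_
    · exact .of_forall fun w => (hint w).aestronglyMeasurable
    · filter_upwards [Iio_mem_nhds (lt_add_one z)] with w hw
      refine .of_forall fun x => ?_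
      rw [Real.norm_of_nonneg (hg.derivInv_pos _).le]
      refine hg.strictMono_derivInv.monotone ?_
      have := mul_nonneg M.2 (norm_nonneg x)
      simp only [mem_Iio] at hw
      have h2 : (M.1 : ℝ) = M := rfl
      rw [h2] at this
      linarith
    · exact .of_forall fun x => (by fun_prop : Continuous fun w => derivInv g (w - M * ‖x‖)).continuousAt
  suffices h : (1 : ℝ) ∈ range F by
    exact Function.invFun_eq (f := F) h
  refine mem_range_of_exists_le_of_exists_ge hcont ?_ ?_
  · refine ⟨deriv g (1 / volume.real X), ?_⟩
    calc F _ ≤ ∫ x in X, 1 / volume.real X := by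
          refine setIntegral_mono (hint _) (hcst _) fun x => ?_
          rw [← hg.derivInv_deriv (one_div_pos.2 hvol)]
          refine hg.strictMono_derivInv.monotone ?_
          rw [hg.derivInv_deriv (one_div_pos.2 hvol)]
          have : (0 : ℝ) ≤ M * ‖x‖ := by positivity
          linarith
      _ = 1 := by simp [hvol.ne']
  -- The shift `M * R` offsets the largest possible `M * ‖x‖` on `X`.
  · refine ⟨deriv g (1 / volume.real X) + M * R, ?_⟩
    calc (1 : ℝ) = ∫ x in X, 1 / volume.real X := by simp [hvol.ne']
      _ ≤ _ := by
          refine setIntegral_mono_on (hcst _) (hint _) hXo.measurableSet fun x hx => ?_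
          conv_lhs => rw [← hg.derivInv_deriv (one_div_pos.2 hvol)]
          refine hg.strictMono_derivInv.monotone ?_
          have : (M : ℝ) * ‖x‖ ≤ M * R := by gcongr; exact hR x hx
          linarith

end IsCongestionIntegrand
-- Null level sets.
/-- Level sets of a strictly differentiable function without critical points are null. -/
theorem volume_level_eq_zero {X : Set (EuclideanSpace ℝ (Fin m))} (hXo : IsOpen X)
    {f : EuclideanSpace ℝ (Fin m) → ℝ}
    (hf : ∀ x ∈ X, ∃ f' : EuclideanSpace ℝ (Fin m) →L[ℝ] ℝ, f' ≠ 0 ∧ HasStrictFDerivAt f f' x)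
    (k : ℝ) : volume {x ∈ X | f x = k} = 0 := by
  have hcont : ContinuousOn f X := fun x hx =>
    (hf x hx).choose_spec.2.hasFDerivAt.continuousAt.continuousWithinAt
  refine measure_null_of_locally_null _ fun x hx => ?_
  obtain ⟨f', hf'0, hf'⟩ := hf x hx.1
  obtain ⟨v, hv⟩ : ∃ v, f' v ≠ 0 := by
    by_contra! h
    exact hf'0 (ContinuousLinearMap.ext h)
  have hv0 : v ≠ 0 := by rintro rfl; simp at hv
  have hvn : 0 < ‖v‖ := norm_pos_iff.2 hv0
  -- With this constant the linearization error along `v` is at most half of the linear term, so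
  -- near `x` no two distinct points of a level set differ by a multiple of `v`.
  have hlo := hf'.isLittleO.def (c := |f' v| / (2 * ‖v‖)) (by positivity)
  rw [nhds_prod_eq] at hlo
  obtain ⟨U, hU, hUp⟩ := mem_prod_self_iff.1 hlo
  obtain ⟨V, hVU, hVo, hxV⟩ := mem_nhds_iff.1 hU
  refine ⟨{z ∈ X | f z = k} ∩ V, inter_mem self_mem_nhdsWithin
    (mem_nhdsWithin_of_mem_nhds (hVo.mem_nhds hxV)), ?_⟩
  have hne : ∀ p ∈ {z ∈ X | f z = k} ∩ V, ∀ q ∈ {z ∈ X | f z = k} ∩ V, ∀ s : ℝ,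
      p - q = s • v → s = 0 := by
    intro p hp q hq s hs
    have h1 := hUp (mk_mem_prod (hVU hp.2) (hVU hq.2))
    simp only [mem_ofPred_eq, hs, hp.1.2, hq.1.2, sub_self, map_smul, smul_eq_mul, zero_sub, Real.norm_eq_abs,
      abs_neg, abs_mul, norm_smul] at h1
    by_contra hs0
    have hs1 : 0 < |s| := abs_pos.2 hs0
    have hv1 : 0 < |f' v| := abs_pos.2 hv
    have : |f' v| / (2 * ‖v‖) * (|s| * ‖v‖) = |s| * |f' v| / 2 := by field_simp
    rw [this] at h1
    have := mul_pos hs1 hv1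
    linarith
  -- Infinitely many disjoint translates, by a bounded sequence of multiples of `v`, force measure
  -- zero.
  refine Measure.addHaar_eq_zero_of_disjoint_translates volume
    (fun n : ℕ => (1 / ((n : ℝ) + 1)) • v) ?_ ?_ ?_
  · refine (Metric.isBounded_closedBall (x := (0 : EuclideanSpace ℝ (Fin m)))
      (r := ‖v‖)).subset ?_
    rintro _ ⟨n, rfl⟩
    rw [mem_closedBall_zero_iff, norm_smul, Real.norm_of_nonneg (by positivity)]
    refine mul_le_of_le_one_left hvn.le ?_
    rw [div_le_one (by positivity)]
    linarith [n.cast_nonneg (α := ℝ)]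
  · intro n l hnl
    refine disjoint_left.2 fun z hz hz' => hnl ?_
    simp only [singleton_add, mem_image] at hz hz'
    obtain ⟨p, hp, rfl⟩ := hz
    obtain ⟨q, hq, hpq⟩ := hz'
    have := hne q hq p hp (1 / ((n : ℝ) + 1) - 1 / ((l : ℝ) + 1)) (by
      rw [sub_smul, sub_eq_sub_iff_add_eq_add, add_comm, hpq, add_comm])
    rw [sub_eq_zero, one_div, one_div, inv_inj] at this
    exact_mod_cast add_right_cancel this
  · have h1 : {z ∈ X | f z = k} = X \ (X ∩ f ⁻¹' {k}ᶜ) := by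
      ext z; simp only [mem_ofPred_eq, Set.mem_sdiff, mem_inter_iff, mem_preimage, mem_compl_iff,
        mem_singleton_iff]; tauto
    rw [h1]
    exact (hXo.measurableSet.diff (hcont.isOpen_inter_preimage hXo
      isOpen_compl_singleton).measurableSet).inter hVo.measurableSet

/-! ### Regularity of `∂c/∂y` and existence of splitting levels. -/

namespace IsAdmissibleCost

variable {X : Set (EuclideanSpace ℝ (Fin m))} {a b : ℝ}
  {c : EuclideanSpace ℝ (Fin m) → ℝ → ℝ} (hc : IsAdmissibleCost X (Ioo a b) c)
  (hXo : IsOpen X)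
include hc hXo

theorem contDiffAt {x : EuclideanSpace ℝ (Fin m)} (hx : x ∈ X) {y : ℝ} (hy : y ∈ Ioo a b) :
    ContDiffAt ℝ 2 (fun p : EuclideanSpace ℝ (Fin m) × ℝ => c p.1 p.2) (x, y) :=
  hc.smooth.contDiffAt (prod_mem_nhds (mem_of_superset (hXo.mem_nhds hx) subset_closure)
    (mem_of_superset (isOpen_Ioo.mem_nhds hy) subset_closure))

omit hc hXo in
theorem hasDerivAt_of_hasFDerivAt {x : EuclideanSpace ℝ (Fin m)} {y : ℝ}
    {L : EuclideanSpace ℝ (Fin m) × ℝ →L[ℝ] ℝ}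
    (h : HasFDerivAt (fun p : EuclideanSpace ℝ (Fin m) × ℝ => c p.1 p.2) L (x, y)) :
    HasDerivAt (fun t => c x t) (L (0, 1)) y :=
  h.comp_hasDerivAt y ((hasDerivAt_const y x).prodMk (hasDerivAt_id y))

theorem contDiffAt_deriv {x : EuclideanSpace ℝ (Fin m)} (hx : x ∈ X) {y : ℝ}
    (hy : y ∈ Ioo a b) : ContDiffAt ℝ 1 (fun z => deriv (fun t => c z t) y) x := by
  have h1 : ContDiffAt ℝ 1 (fun z => fderiv ℝ
      (fun p : EuclideanSpace ℝ (Fin m) × ℝ => c p.1 p.2) (z, y) (0, 1)) x := by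
    have h2 : ContDiffAt ℝ 1 (fun z => fderiv ℝ
        (fun p : EuclideanSpace ℝ (Fin m) × ℝ => c p.1 p.2) (z, y)) x :=
      ((hc.contDiffAt hXo hx hy).fderiv_right (m := 1) (by norm_num)).comp x
        (contDiffAt_id.prodMk contDiffAt_const)
    exact h2.clm_apply contDiffAt_const
  refine h1.congr_of_eventuallyEq ?_
  filter_upwards [hXo.mem_nhds hx] with z hz
  exact (hasDerivAt_of_hasFDerivAt
    ((hc.contDiffAt hXo hz hy).differentiableAt two_ne_zero).hasFDerivAt).deriv

theorem continuousOn_deriv {y : ℝ} (hy : y ∈ Ioo a b) :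
    ContinuousOn (fun z => deriv (fun t => c z t) y) X := fun _ hx =>
  (hc.contDiffAt_deriv hXo hx hy).continuousAt.continuousWithinAt

theorem volume_level {y : ℝ} (hy : y ∈ Ioo a b) (k : ℝ) :
    volume {x ∈ X | deriv (fun t => c x t) y = k} = 0 :=
  volume_level_eq_zero hXo (fun x hx => ⟨_, hc.nondegenerate x hx y hy,
    (hc.contDiffAt_deriv hXo hx hy).hasStrictFDerivAt one_ne_zero⟩) k

theorem measurableSet_superLevel {y : ℝ} (hy : y ∈ Ioo a b) (k : ℝ) :
    MeasurableSet (superLevel X c y k) := by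
  have h1 : superLevel X c y k = X \ (X ∩ (fun x => deriv (fun t => c x t) y) ⁻¹' Iio k) := by
    ext z; simp only [superLevel, mem_ofPred_eq, Set.mem_sdiff, mem_inter_iff, mem_preimage, mem_Iio,
      ← not_lt]; tauto
  rw [h1]
  exact hXo.measurableSet.diff
    ((hc.continuousOn_deriv hXo hy).isOpen_inter_preimage hXo isOpen_Iio).measurableSet

/-- The boundary of `X` is arbitrary, so `deriv` is not known to extend continuously to it. The `C²`
hypothesis still provides, near each point of the compact closure, a locally bounded derivative
within the closed product, and this is the true derivative at points over `X`. -/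
theorem exists_abs_deriv_le (hXb : Bornology.IsBounded X) {y : ℝ} (hy : y ∈ Ioo a b) :
    ∃ L, ∀ x ∈ X, |deriv (fun t => c x t) y| ≤ L := by
  suffices h : ∃ L, ∀ x ∈ closure X ∩ X, |deriv (fun t => c x t) y| ≤ L from
    h.imp fun L hL x hx => hL x ⟨subset_closure hx, hx⟩
  refine hXb.isCompact_closure.induction_on
    (p := fun s => ∃ L, ∀ x ∈ s ∩ X, |deriv (fun t => c x t) y| ≤ L) ⟨0, by simp⟩ ?_ ?_ ?_
  · rintro s t hst ⟨L, hL⟩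
    exact ⟨L, fun x hx => hL x ⟨hst hx.1, hx.2⟩⟩
  · rintro s t ⟨L, hL⟩ ⟨L', hL'⟩
    refine ⟨max L L', ?_⟩
    rintro x ⟨hx | hx, hxX⟩
    · exact (hL x ⟨hx, hxX⟩).trans (le_max_left _ _)
    · exact (hL' x ⟨hx, hxX⟩).trans (le_max_right _ _)
  · intro x hx
    have hmem : (x, y) ∈ closure X ×ˢ closure (Ioo a b) := ⟨hx, subset_closure hy⟩
    have h1 : ContDiffWithinAt ℝ (1 + 1) (fun p : EuclideanSpace ℝ (Fin m) × ℝ => c p.1 p.2)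
        (closure X ×ˢ closure (Ioo a b)) (x, y) := by
      have := hc.smooth _ hmem
      norm_num
      exact this
    obtain ⟨u, hu, -, f', hf', hf'c⟩ :=
      (contDiffWithinAt_succ_iff_hasFDerivWithinAt (by norm_num)).1 h1
    rw [insert_eq_of_mem hmem] at hu
    have hxu : (x, y) ∈ u := mem_of_mem_nhdsWithin hmem hu
    have h2 : ∀ᶠ q in 𝓝[u] (x, y), ‖f' q‖ < ‖f' (x, y)‖ + 1 :=
      hf'c.continuousWithinAt.norm.eventually (gt_mem_nhds (lt_add_one _))
    have h3 : ∀ᶠ q in 𝓝[closure X ×ˢ closure (Ioo a b)] (x, y),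
        q ∈ u ∧ ‖f' q‖ < ‖f' (x, y)‖ + 1 :=
      (eventually_mem_set.2 hu).and (nhdsWithin_le_of_mem hu h2)
    obtain ⟨O, hO, hxO, hOs⟩ := mem_nhdsWithin.1 h3
    have h4 : ∀ᶠ z in 𝓝 x, (z, y) ∈ O :=
      (by fun_prop : Continuous fun z : EuclideanSpace ℝ (Fin m) => (z, y)).continuousAt.eventually
        (hO.mem_nhds hxO)
    refine ⟨{z | (z, y) ∈ O}, mem_nhdsWithin_of_mem_nhds h4,
      (‖f' (x, y)‖ + 1) * ‖((0, 1) : EuclideanSpace ℝ (Fin m) × ℝ)‖, ?_⟩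
    rintro z ⟨hz, hzX⟩
    have hzu := hOs ⟨hz, subset_closure hzX, subset_closure hy⟩
    have hun : u ∈ 𝓝 (z, y) := by
      refine mem_of_superset (inter_mem (hO.mem_nhds hz)
        (prod_mem_nhds (hXo.mem_nhds hzX) (isOpen_Ioo.mem_nhds hy))) fun q hq => ?_
      exact (hOs ⟨hq.1, subset_closure hq.2.1, subset_closure hq.2.2⟩).1
    rw [(hasDerivAt_of_hasFDerivAt ((hf' _ hzu.1).hasFDerivAt hun)).deriv,
      ← Real.norm_eq_abs]
    exact ((f' (z, y)).le_opNorm _).trans (by gcongr; exact hzu.2.le)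

/-- Every fraction of the mass is cut off by some superlevel set of `∂c/∂y (·, y)`. -/
theorem exists_level (hXb : Bornology.IsBounded X) {y : ℝ} (hy : y ∈ Ioo a b)
    {μ : Measure (EuclideanSpace ℝ (Fin m))} [IsProbabilityMeasure μ] (hμX : μ Xᶜ = 0)
    (hμ : μ ≪ volume) {p : ENNReal} (hp : p ≤ 1) : ∃ k, μ (superLevel X c y k) = p := by
  obtain ⟨L, hL⟩ := hc.exists_abs_deriv_le hXo hXb hy
  set φ : EuclideanSpace ℝ (Fin m) → ℝ := fun x => deriv (fun t => c x t) y with hφ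
  have hμr : μ.restrict X = μ :=
    Measure.restrict_eq_self_of_ae_mem (mem_ae_iff.2 hμX)
  have hφm : AEMeasurable φ μ := by
    rw [← hμr]
    exact (hc.continuousOn_deriv hXo hy).aemeasurable hXo.measurableSet
  set κ := μ.map φ with hκ
  have : IsProbabilityMeasure κ := Measure.isProbabilityMeasure_map hφm
  have hκs (s : Set ℝ) (hs : MeasurableSet s) : κ s = μ (X ∩ φ ⁻¹' s) := by
    rw [hκ, Measure.map_apply_of_aemeasurable hφm hs]
    conv_lhs => rw [← hμr]
    rw [Measure.restrict_apply' hXo.measurableSet, inter_comm]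
  -- Atoms of the law `κ` of `∂c/∂y` would be level sets of positive mass. Without atoms its
  -- distribution function is continuous and takes every intermediate value.
  have : NullSingletonClass κ := ⟨fun k => by
    rw [hκs _ (measurableSet_singleton k)]
    exact hμ (hc.volume_level hXo hy k)⟩
  -- The base point `-L - 1` lies below all values of `φ`, so this integral is the distribution
  -- function of `κ`.
  have hcont : Continuous fun k => ∫ _ in (-L - 1)..k, (1 : ℝ) ∂κ :=
    intervalIntegral.continuous_primitive (fun _ _ => intervalIntegrable_const) _
  have hval (k : ℝ) (hk : -L - 1 ≤ k) :
      ∫ _ in (-L - 1)..k, (1 : ℝ) ∂κ = 1 - (μ (superLevel X c y k)).toReal := by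
    rw [intervalIntegral.integral_of_le hk]
    have h1 : κ (Iio (-L - 1)) = 0 := by
      rw [hκs _ measurableSet_Iio]
      convert measure_empty (μ := μ)
      refine eq_empty_of_forall_notMem fun x hx => ?_
      have h2 := (abs_le.1 (hL x hx.1)).1
      have h3 : φ x < -L - 1 := hx.2
      linarith
    have h4 : κ.real (Ioc (-L - 1) k) = κ.real (Iio k) := by
      rw [measureReal_congr (Ico_ae_eq_Ioc (μ := κ) (a := -L - 1) (b := k)).symm]
      refine measureReal_congr ?_
      have : (Iio k : Set ℝ) = Iio (-L - 1) ∪ Ico (-L - 1) k := (Iio_union_Ico_eq_Iio hk).symm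
      rw [this]
      exact (union_ae_eq_right_of_ae_eq_empty (ae_eq_empty.2 h1)).symm
    have h5 : μ (superLevel X c y k) = κ (Ici k) := (hκs _ measurableSet_Ici).symm
    have h6 : κ.real (Iio k) = 1 - κ.real (Ici k) := by
      rw [← compl_Ici, probReal_compl_eq_one_sub measurableSet_Ici]
    simp only [integral_const, smul_eq_mul, mul_one, measureReal_restrict_apply_univ]
    rw [h4, h6, h5, Measure.real]
  have hX1 : μ X = 1 := by
    rw [← prob_compl_eq_zero_iff hXo.measurableSet]; exact hμX
  have hL0 : -L - 1 ≤ L + 1 := by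
    obtain ⟨x, hx⟩ : X.Nonempty := by
      by_contra h
      rw [not_nonempty_iff_eq_empty.1 h] at hX1
      simp at hX1
    have := (abs_nonneg _).trans (hL x hx)
    linarith
  have h0 : superLevel X c y (L + 1) = ∅ := by
    refine eq_empty_of_forall_notMem fun x hx => ?_
    have h2 := (abs_le.1 (hL x hx.1)).2
    have h3 := hx.2
    linarith
  have hp1 : p.toReal ≤ 1 := by
    simpa using ENNReal.toReal_mono ENNReal.one_ne_top hp
  obtain ⟨k, hk, hkv⟩ := intermediate_value_Icc hL0 hcont.continuousOn
    (show 1 - p.toReal ∈ _ from ⟨by simpa using hp1, by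
      rw [hval _ hL0, h0]; simp⟩)
  refine ⟨k, ?_⟩
  simp only at hkv
  rw [hval _ hk.1] at hkv
  have h7 : (μ (superLevel X c y k)).toReal = p.toReal := by linarith
  exact (ENNReal.toReal_eq_toReal_iff' (measure_ne_top _ _)
    (ne_top_of_le_ne_top ENNReal.one_ne_top hp)).1 h7

end IsAdmissibleCost
-- Effect of moving mass on the transport cost.
/-- Cutting off the cost outside `closure X × [a, b]` makes it a bounded Borel function. -/
theorem exists_truncated_cost {X : Set (EuclideanSpace ℝ (Fin m))}
    (hXb : Bornology.IsBounded X) {a b : ℝ}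
    {c : EuclideanSpace ℝ (Fin m) → ℝ → ℝ}
    (hcc : ContinuousOn (fun p : EuclideanSpace ℝ (Fin m) × ℝ => c p.1 p.2)
      (closure X ×ˢ Icc a b)) :
    ∃ C : EuclideanSpace ℝ (Fin m) × ℝ → ℝ, Measurable C ∧ (∃ L, ∀ p, |C p| ≤ L) ∧
      ∀ p ∈ closure X ×ˢ Icc a b, C p = c p.1 p.2 := by
  classical
  have hms : MeasurableSet (closure X ×ˢ Icc a b) := isClosed_closure.measurableSet.prod measurableSet_Icc
  refine ⟨(closure X ×ˢ Icc a b).piecewise (fun p => c p.1 p.2) 0,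
    hcc.measurable_piecewise continuousOn_const hms, ?_, fun p hp => piecewise_eq_of_mem _ _ _ hp⟩
  obtain ⟨L, hL⟩ := (hXb.isCompact_closure.prod isCompact_Icc).exists_bound_of_continuousOn hcc
  refine ⟨max L 0, fun p => ?_⟩
  by_cases hp : p ∈ closure X ×ˢ Icc a b
  · rw [piecewise_eq_of_mem _ _ _ hp]; exact (hL p hp).trans (le_max_left _ _)
  · rw [piecewise_eq_of_notMem _ _ _ hp]; simp

/-- A coupling lives on the product of the supports of its marginals. -/
theorem ae_mem_of_coupling {α β : Type*} [MeasurableSpace α] [MeasurableSpace β]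
    {γ : Measure (α × β)} {μ : Measure α} {ν : Measure β} (h1 : γ.map Prod.fst = μ)
    (h2 : γ.map Prod.snd = ν) {s : Set α} {t : Set β} (hs : ∀ᵐ x ∂μ, x ∈ s) (ht : ∀ᵐ y ∂ν, y ∈ t) :
    ∀ᵐ p ∂γ, p ∈ s ×ˢ t := by
  rw [← h1] at hs
  rw [← h2] at ht
  filter_upwards [ae_of_ae_map measurable_fst.aemeasurable hs,
    ae_of_ae_map measurable_snd.aemeasurable ht] with p hp1 hp2
  exact ⟨hp1, hp2⟩

/-- Redistribute a fraction `ε` of the mass of `μ` on `A` according to the measure `l`. -/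
noncomputable def redistribute (μ : Measure (EuclideanSpace ℝ (Fin m))) (A : Set (EuclideanSpace ℝ (Fin m)))
    (ε : ℝ) (l : Measure (EuclideanSpace ℝ (Fin m))) : Measure (EuclideanSpace ℝ (Fin m)) :=
  μ.restrict Aᶜ + (ENNReal.ofReal (1 - ε) • μ.restrict A + (ENNReal.ofReal ε * μ A) • l)

section

variable {X : Set (EuclideanSpace ℝ (Fin m))} (hXb : Bornology.IsBounded X) {a b : ℝ}
  {c : EuclideanSpace ℝ (Fin m) → ℝ → ℝ}
  (hcc : ContinuousOn (fun p : EuclideanSpace ℝ (Fin m) × ℝ => c p.1 p.2)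
    (closure X ×ˢ Icc a b))
  {μ : Measure (EuclideanSpace ℝ (Fin m))} [IsProbabilityMeasure μ]
  (hμ : ∀ᵐ x ∂μ, x ∈ closure X)
  {ν : Measure ℝ} [IsProbabilityMeasure ν] (hν : ∀ᵐ y ∂ν, y ∈ Icc a b)

theorem isProbabilityMeasure_redistribute {A : Set (EuclideanSpace ℝ (Fin m))}
    (hA : MeasurableSet A) {ε : ℝ} (h0 : 0 ≤ ε) (h1 : ε ≤ 1)
    (l : Measure (EuclideanSpace ℝ (Fin m))) [IsProbabilityMeasure l] :
    IsProbabilityMeasure (redistribute μ A ε l) := by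
  refine ⟨?_⟩
  simp only [redistribute, Measure.add_apply, Measure.smul_apply, Measure.restrict_apply_univ,
    measure_univ, smul_eq_mul, mul_one]
  rw [← add_mul, ← ENNReal.ofReal_add (by linarith) h0, sub_add_cancel, ENNReal.ofReal_one,
    one_mul, add_comm, measure_add_measure_compl hA, measure_univ]

omit [IsProbabilityMeasure μ] [IsProbabilityMeasure ν] in
include hXb hcc hμ hν in
theorem transportCost_bddBelow :
    BddBelow {r : ℝ | ∃ γ : Measure (EuclideanSpace ℝ (Fin m) × ℝ), IsProbabilityMeasure γ ∧
    γ.map Prod.fst = μ ∧ γ.map Prod.snd = ν ∧ r = ∫ p, c p.1 p.2 ∂γ} := by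
  obtain ⟨C, hCm, ⟨L, hL⟩, hC⟩ := exists_truncated_cost hXb hcc
  refine ⟨-L, ?_⟩
  rintro _ ⟨γ, hγ, h1, h2, rfl⟩
  have h3 : ∫ p, c p.1 p.2 ∂γ = ∫ p, C p ∂γ := integral_congr_ae <| by
    filter_upwards [ae_mem_of_coupling h1 h2 hμ hν] with p hp using (hC p hp).symm
  rw [h3]
  have h4 := norm_integral_le_of_norm_le_const (μ := γ) (f := C) (C := L) (.of_forall hL)
  simp only [probReal_univ, mul_one] at h4
  exact (abs_le.1 h4).1

include hXb hcc hμ hν in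
-- In any coupling of `μ` and `ν`, a share `ε` of the mass over `A` keeps its target `y` but has its
-- source `x` redrawn from `l`. Each change costs at most `M‖x' - x‖ ≤ M‖x‖ + M‖x'‖`.
theorem transportCost_redistribute_le {M : NNReal}
    (hM : ∀ y ∈ Icc a b, LipschitzOnWith M (fun x => c x y) (closure X))
    {A : Set (EuclideanSpace ℝ (Fin m))} (hA : MeasurableSet A) {ε : ℝ} (h0 : 0 ≤ ε) (h1 : ε ≤ 1)
    (l : Measure (EuclideanSpace ℝ (Fin m))) [IsProbabilityMeasure l]
    (hl : ∀ᵐ x ∂l, x ∈ closure X) :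
    transportCost c (redistribute μ A ε l) ν ≤ transportCost c μ ν +
      ε * ((∫ x in A, M * ‖x‖ ∂μ) + μ.real A * ∫ x, M * ‖x‖ ∂l) := by
  obtain ⟨C, hCm, ⟨L, hL⟩, hC⟩ := exists_truncated_cost hXb hcc
  have hprob := isProbabilityMeasure_redistribute (μ := μ) hA h0 h1 l
  have hμ' : ∀ᵐ x ∂(redistribute μ A ε l), x ∈ closure X := by
    simp only [redistribute, ae_add_measure_iff]
    exact ⟨ae_restrict_of_ae hμ, Measure.ae_smul_measure (ae_restrict_of_ae hμ) _,
      Measure.ae_smul_measure hl _⟩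
  have hCi {γ : Measure (EuclideanSpace ℝ (Fin m) × ℝ)} (hγ : IsFiniteMeasure γ) :
      Integrable C γ :=
    .of_bound hCm.aestronglyMeasurable L (.of_forall hL)
  have hnorm {ρ : Measure (EuclideanSpace ℝ (Fin m))} (hρf : IsFiniteMeasure ρ)
      (hρ : ∀ᵐ x ∂ρ, x ∈ closure X) :
      Integrable (fun x => M * ‖x‖) ρ := by
    obtain ⟨R, hR⟩ := hXb.closure.exists_norm_le
    refine .of_bound (by fun_prop) (M * R) ?_
    filter_upwards [hρ] with x hx
    rw [Real.norm_of_nonneg (by positivity)]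
    gcongr
    exact hR x hx
  rw [← sub_le_iff_le_add]
  -- The product coupling shows that the infimum is not over the empty set.
  refine le_csInf ⟨_, μ.prod ν, inferInstance, ?_, ?_, rfl⟩ ?_
  · simp [Measure.map_fst_prod]
  · simp [Measure.map_snd_prod]
  rintro _ ⟨γ, hγ, hγ1, hγ2, rfl⟩
  rw [sub_le_iff_le_add]
  set S : Set (EuclideanSpace ℝ (Fin m) × ℝ) := Prod.fst ⁻¹' A with hS
  have hSm : MeasurableSet S := measurable_fst hA
  set σ : Measure ℝ := (γ.restrict S).map Prod.snd with hσ
  -- `σ` is the law of the targets of the mass over `A`; using it in the product keeps the second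
  -- marginal equal to `ν`.
  set γ' : Measure (EuclideanSpace ℝ (Fin m) × ℝ) :=
    γ.restrict Sᶜ + (ENNReal.ofReal (1 - ε) • γ.restrict S + ENNReal.ofReal ε • l.prod σ) with hγ'
  have hσu : σ univ = μ A := by
    rw [hσ, Measure.map_apply measurable_snd .univ, preimage_univ, Measure.restrict_apply_univ,
      ← hγ1, Measure.map_apply measurable_fst hA]
  have hfst : γ'.map Prod.fst = redistribute μ A ε l := by
    have e1 (B : Set (EuclideanSpace ℝ (Fin m))) (hB : MeasurableSet B) :
        (γ.restrict (Prod.fst ⁻¹' B)).map Prod.fst = μ.restrict B := by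
      rw [← hγ1, Measure.restrict_map measurable_fst hB]
    rw [hγ', redistribute, Measure.map_add _ _ measurable_fst, Measure.map_add _ _ measurable_fst,
      Measure.map_smul, Measure.map_smul, Measure.map_fst_prod, hσu, e1 A hA,
      show Sᶜ = Prod.fst ⁻¹' Aᶜ from rfl, e1 _ hA.compl, smul_smul]
  have hsnd : γ'.map Prod.snd = ν := by
    rw [hγ', Measure.map_add _ _ measurable_snd, Measure.map_add _ _ measurable_snd,
      Measure.map_smul, Measure.map_smul, Measure.map_snd_prod, measure_univ, one_smul, ← hσ,
      ← add_smul, ← ENNReal.ofReal_add (by linarith) h0, sub_add_cancel, ENNReal.ofReal_one,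
      one_smul, hσ, ← Measure.map_add _ _ measurable_snd, add_comm,
      Measure.restrict_add_restrict_compl hSm, hγ2]
  have hγ'p : IsProbabilityMeasure γ' := by
    rw [← hfst] at hprob
    exact Measure.isProbabilityMeasure_of_map Prod.fst
  refine (csInf_le (transportCost_bddBelow hXb hcc hμ' hν) ⟨γ', hγ'p, hfst, hsnd, rfl⟩).trans ?_
  have i1 : ∫ p, c p.1 p.2 ∂γ' = ∫ p, C p ∂γ' := integral_congr_ae <| by
    filter_upwards [ae_mem_of_coupling hfst hsnd hμ' hν] with p hp using (hC p hp).symm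
  have hγK := ae_mem_of_coupling hγ1 hγ2 hμ hν
  have i2 : ∫ p, c p.1 p.2 ∂γ = ∫ p, C p ∂γ := integral_congr_ae <| by
    filter_upwards [hγK] with p hp using (hC p hp).symm
  have i3 : ∫ p, C p ∂γ' = ∫ p in Sᶜ, C p ∂γ + ((1 - ε) * ∫ p in S, C p ∂γ
      + ε * ∫ p, C p ∂(l.prod σ)) := by
    have j0 : Integrable C (l.prod σ) := hCi inferInstance
    rw [hγ', integral_add_measure (hCi inferInstance)
      (((hCi inferInstance).smul_measure ENNReal.ofReal_ne_top).add_measure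
        (j0.smul_measure ENNReal.ofReal_ne_top)),
      integral_add_measure ((hCi inferInstance).smul_measure ENNReal.ofReal_ne_top)
        (j0.smul_measure ENNReal.ofReal_ne_top), integral_smul_measure, integral_smul_measure,
      ENNReal.toReal_ofReal h0, ENNReal.toReal_ofReal (by linarith), smul_eq_mul, smul_eq_mul]
  have i4 : ∫ p, C p ∂(l.prod σ) ≤ ∫ p in S, C p ∂γ +
      ((∫ x in A, M * ‖x‖ ∂μ) + μ.real A * ∫ x, M * ‖x‖ ∂l) := by
    have hln := hnorm inferInstance hl
    have hCl (y : ℝ) : Integrable (fun x => C (x, y)) l :=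
      .of_bound (hCm.comp (by fun_prop)).aestronglyMeasurable L (.of_forall fun x => hL (x, y))
    have hCint : Measurable fun y => ∫ x, C (x, y) ∂l :=
      (StronglyMeasurable.integral_prod_left' (μ := l) hCm.stronglyMeasurable).measurable
    rw [integral_prod_symm _ (hCi inferInstance), hσ, integral_map measurable_snd.aemeasurable
      hCint.aestronglyMeasurable]
    have j1 : ∫ x in A, M * ‖x‖ ∂μ = ∫ p in S, M * ‖p.1‖ ∂γ := by
      rw [← hγ1, setIntegral_map hA (by fun_prop) measurable_fst.aemeasurable]
    have j2 : μ.real A * ∫ x, M * ‖x‖ ∂l = ∫ p in S, (∫ x, M * ‖x‖ ∂l) ∂γ := by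
      rw [setIntegral_const, smul_eq_mul, ← hγ1, map_measureReal_apply measurable_fst hA]
    have j3 : IntegrableOn (fun p : EuclideanSpace ℝ (Fin m) × ℝ => M * ‖p.1‖) S γ := by
      have : Integrable (fun x => M * ‖x‖) (γ.map Prod.fst) := by
        rw [hγ1]; exact hnorm inferInstance hμ
      exact (this.comp_measurable measurable_fst).integrableOn
    have j4 : IntegrableOn (fun p : EuclideanSpace ℝ (Fin m) × ℝ =>
        M * ‖p.1‖ + ∫ x, M * ‖x‖ ∂l) S γ := j3.add (integrable_const _)
    rw [j1, j2, ← integral_add j3 (integrable_const _), ← integral_add (hCi inferInstance) j4]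
    refine integral_mono_ae ?_ ((hCi inferInstance).add j4) ?_
    · refine .of_bound (hCint.comp measurable_snd).aestronglyMeasurable L (.of_forall fun p => ?_)
      have := norm_integral_le_of_norm_le_const (μ := l) (f := fun x => C (x, p.2))
        (.of_forall fun x => hL (x, p.2))
      simpa using this
    · filter_upwards [ae_restrict_of_ae hγK] with p hp
      have : ∫ x, C (x, p.2) ∂l ≤ ∫ x, (C p + M * ‖p.1‖) + M * ‖x‖ ∂l := by
        refine integral_mono_ae (hCl _) ((integrable_const _).add hln) ?_
        filter_upwards [hl] with x hx
        rw [hC (x, p.2) ⟨hx, hp.2⟩, hC p hp]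
        have k1 := (hM p.2 hp.2).dist_le_mul x hx p.1 hp.1
        rw [Real.dist_eq, dist_eq_norm] at k1
        have k2 := mul_le_mul_of_nonneg_left (norm_sub_le x p.1) M.2
        have k3 := le_abs_self (c x p.2 - c p.1 p.2)
        have k4 : (M.1 : ℝ) = M := rfl
        rw [k4, mul_add] at k2
        simp only
        linarith
      rw [integral_add (integrable_const _) hln] at this
      simpa [add_assoc] using this
  rw [i1, i2, i3, ← integral_add_compl hSm (hCi inferInstance : Integrable C γ)]
  have := mul_le_mul_of_nonneg_left i4 h0
  linarith

end

/-! ### Congestion of explicit densities, and finiteness at a minimizer. -/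

theorem withDensity_ofReal_absolutelyContinuous {X : Set (EuclideanSpace ℝ (Fin m))}
    (hX : MeasurableSet X) {h : EuclideanSpace ℝ (Fin m) → ℝ} (hX0 : ∀ x ∉ X, h x = 0) :
    volume.withDensity (fun x => ENNReal.ofReal (h x)) ≪ volume.restrict X := by
  have h1 : (fun x => ENNReal.ofReal (h x)) = X.indicator fun x => ENNReal.ofReal (h x) := by
    refine (indicator_eq_self.2 fun x hx => ?_).symm
    by_contra hxX
    simp [hX0 x hxX] at hx
  rw [h1, withDensity_indicator hX]
  exact withDensity_absolutelyContinuous _ _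

theorem congestion_withDensity {X : Set (EuclideanSpace ℝ (Fin m))} (hX : MeasurableSet X)
    (g : ℝ → ℝ) {h : EuclideanSpace ℝ (Fin m) → ℝ} (hm : Measurable h) (h0 : ∀ x, 0 ≤ h x)
    (hX0 : ∀ x ∉ X, h x = 0) (hi : IntegrableOn (fun x => g (h x)) X) :
    congestion X g (volume.withDensity fun x => ENNReal.ofReal (h x)) =
      ((∫ x in X, g (h x) : ℝ) : EReal) := by
  have h1 : (fun x => g (h x)) =ᵐ[volume.restrict X] fun x =>
      g (((volume.withDensity fun x => ENNReal.ofReal (h x)).rnDeriv volume x).toReal) := by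
    filter_upwards [ae_restrict_of_ae (Measure.rnDeriv_withDensity volume hm.ennreal_ofReal)]
      with x hx
    rw [hx, ENNReal.toReal_ofReal (h0 x)]
  rw [congestion, if_pos ⟨withDensity_ofReal_absolutelyContinuous hX hX0, hi.congr h1⟩,
    integral_congr_ae h1]

/-- The uniform measure is the competitor that forces a minimizer to have finite congestion, hence a
density. -/
theorem congestion_uniform_ne_top {X : Set (EuclideanSpace ℝ (Fin m))} (hXo : IsOpen X)
    (hXb : Bornology.IsBounded X) (g : ℝ → ℝ) :
    congestion X g (ProbabilityTheory.cond volume X) ≠ ⊤ := by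
  have hX := hXo.measurableSet
  have h1 : ProbabilityTheory.cond volume X = volume.withDensity fun x =>
      ENNReal.ofReal (X.indicator (fun _ => (volume X).toReal⁻¹) x) := by
    rcases eq_or_ne (volume X) 0 with h0 | h0
    · have hX0 : X = ∅ := hXo.measure_eq_zero_iff volume |>.1 h0
      simp [hX0, ProbabilityTheory.cond]
    have : (fun x => ENNReal.ofReal (X.indicator (fun _ => (volume X).toReal⁻¹) x)) =
        X.indicator fun _ => (volume X)⁻¹ := by
      ext x
      by_cases hx : x ∈ X
      · simp [hx, ENNReal.ofReal_inv_of_pos (ENNReal.toReal_pos h0 hXb.measure_lt_top.ne),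
          hXb.measure_lt_top.ne]
      · simp [hx]
    rw [this, withDensity_indicator hX, withDensity_const, ProbabilityTheory.cond]
  rw [h1, congestion_withDensity hX g (measurable_const.indicator hX)
    (fun x => indicator_nonneg (fun _ _ => by positivity) x)
    (fun x hx => indicator_of_notMem hx _)]
  · exact EReal.coe_ne_top _
  · refine IntegrableOn.congr_fun (f := fun _ => g ((volume X).toReal⁻¹))
      (integrableOn_of_continuous hXb continuous_const) (fun x hx => by simp [hx]) hX

namespace IsMinimizer

variable {X : Set (EuclideanSpace ℝ (Fin m))} {c : EuclideanSpace ℝ (Fin m) → ℝ → ℝ}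
  {g : ℝ → ℝ} {ν : Measure ℝ} {μ : Measure (EuclideanSpace ℝ (Fin m))}
  (hμ : IsMinimizer X c g ν μ) (hXo : IsOpen X) (hXb : Bornology.IsBounded X)
  (hXn : X.Nonempty)
include hμ hXo hXb hXn

theorem congestion_ne_top : congestion X g μ ≠ ⊤ := by
  intro h
  have hp : IsProbabilityMeasure (ProbabilityTheory.cond volume X) :=
    ProbabilityTheory.cond_isProbabilityMeasure_of_finite (hXo.measure_pos volume hXn).ne'
      hXb.measure_lt_top.ne
  have h1 := hμ.2 (ProbabilityTheory.cond volume X) hp (by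
    have : ProbabilityTheory.cond volume X Xᶜ = 0 := by
      simp [ProbabilityTheory.cond_apply hXo.measurableSet]
    exact measure_mono_null (compl_subset_compl.2 subset_closure) this)
  rw [h, EReal.coe_add_top, top_le_iff] at h1
  exact (EReal.add_ne_top (EReal.coe_ne_top _) (congestion_uniform_ne_top hXo hXb g)) h1

theorem absolutelyContinuous : μ ≪ volume.restrict X := by
  have h := hμ.congestion_ne_top hXo hXb hXn
  rw [congestion] at h
  by_contra hac
  exact h (if_neg fun h' => hac h'.1)

/-- A density of a minimizer for which its congestion is finite. -/
theorem exists_density : ∃ r : EuclideanSpace ℝ (Fin m) → ℝ, Measurable r ∧ (∀ x, 0 ≤ r x) ∧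
    (∀ x ∉ X, r x = 0) ∧ μ = volume.withDensity (fun x => ENNReal.ofReal (r x)) ∧
    Integrable r ∧ IntegrableOn (fun x => g (r x)) X ∧
    congestion X g μ = ((∫ x in X, g (r x) : ℝ) : EReal) := by
  have hX := hXo.measurableSet
  have hprob := hμ.1.1
  have hac := hμ.absolutelyContinuous hXo hXb hXn
  have hac' : μ ≪ volume := hac.trans Measure.restrict_le_self.absolutelyContinuous
  have hgi : IntegrableOn (fun x => g (μ.rnDeriv volume x).toReal) X := by
    have h := hμ.congestion_ne_top hXo hXb hXn
    rw [congestion] at h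
    by_contra hac
    exact h (if_neg fun h' => hac h'.2)
  set r : EuclideanSpace ℝ (Fin m) → ℝ := X.indicator fun x => (μ.rnDeriv volume x).toReal with hr
  have hrm : Measurable r := (Measure.measurable_rnDeriv _ _).ennreal_toReal.indicator hX
  have hr0 : ∀ x, 0 ≤ r x := fun x => indicator_nonneg (fun _ _ => ENNReal.toReal_nonneg) x
  have hrX : ∀ x ∉ X, r x = 0 := fun x hx => indicator_of_notMem hx _
  have hμr : μ = volume.withDensity fun x => ENNReal.ofReal (r x) := by
    have h1 : μ.restrict X = μ := by
      refine Measure.restrict_eq_self_of_ae_mem ?_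
      exact hac.ae_le (ae_restrict_mem hX)
    have h2 : (fun x => ENNReal.ofReal (r x)) =ᵐ[volume] X.indicator (μ.rnDeriv volume) := by
      filter_upwards [Measure.rnDeriv_lt_top μ volume] with x hx
      by_cases hxX : x ∈ X
      · simp [hr, hxX, ENNReal.ofReal_toReal hx.ne]
      · simp [hr, hxX]
    rw [withDensity_congr_ae h2, withDensity_indicator hX, ← restrict_withDensity hX,
      Measure.withDensity_rnDeriv_eq _ _ hac', h1]
  have hri : Integrable r := by
    refine ⟨hrm.aestronglyMeasurable, ?_⟩
    rw [hasFiniteIntegral_iff_ofReal (.of_forall hr0)]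
    have : μ univ = ∫⁻ x, ENNReal.ofReal (r x) := by
      conv_lhs => rw [hμr]
      rw [withDensity_apply _ .univ, Measure.restrict_univ]
    rw [← this]
    exact measure_lt_top _ _
  have hgr : IntegrableOn (fun x => g (r x)) X :=
    hgi.congr_fun (fun x hx => by simp [hr, hx]) hX
  refine ⟨r, hrm, hr0, hrX, hμr, hri, hgr, ?_⟩
  conv_lhs => rw [hμr]
  exact congestion_withDensity hX g hrm hr0 hrX hgr

end IsMinimizer

/-! ### First variation and the density bound. -/

/-- Density of a redistributed measure. -/
theorem redistribute_withDensity {r : EuclideanSpace ℝ (Fin m) → ℝ} (hrm : Measurable r)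
    (hr0 : ∀ x, 0 ≤ r x) {A B : Set (EuclideanSpace ℝ (Fin m))}
    (hA : MeasurableSet A) (hB : MeasurableSet B) (hAB : Disjoint A B) (hB0 : volume B ≠ 0)
    (hB1 : volume B ≠ ⊤) {ε : ℝ} (h0 : 0 ≤ ε) (h1 : ε ≤ 1)
    {μ : Measure (EuclideanSpace ℝ (Fin m))} [IsProbabilityMeasure μ]
    (hμ : μ = volume.withDensity fun x => ENNReal.ofReal (r x)) :
    redistribute μ A ε (ProbabilityTheory.cond volume B) = volume.withDensity fun x =>
      ENNReal.ofReal (r x - A.indicator (fun x => ε * r x) x +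
        B.indicator (fun _ => ε * μ.real A / volume.real B) x) := by
  classical
  set δ := ε * μ.real A / volume.real B with hδ
  have hrm' := hrm.ennreal_ofReal
  have hsplit : (fun x => ENNReal.ofReal (r x - A.indicator (fun x => ε * r x) x +
      B.indicator (fun _ => δ) x)) =
      Aᶜ.indicator (fun x => ENNReal.ofReal (r x)) +
        (ENNReal.ofReal (1 - ε) • A.indicator (fun x => ENNReal.ofReal (r x)) +
          B.indicator fun _ => ENNReal.ofReal δ) := by
    ext x
    by_cases hxA : x ∈ A
    · have hxB : x ∉ B := disjoint_left.1 hAB hxA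
      simp only [Pi.add_apply, Pi.smul_apply, hxA, hxB, indicator_of_mem, indicator_of_notMem,
        not_false_eq_true, mem_compl_iff, not_true, smul_eq_mul, zero_add, add_zero]
      rw [← ENNReal.ofReal_mul (by linarith)]
      ring_nf
    · by_cases hxB : x ∈ B
      · simp only [Pi.add_apply, Pi.smul_apply, hxA, hxB, indicator_of_mem, indicator_of_notMem,
          not_false_eq_true, mem_compl_iff, smul_eq_mul, mul_zero, zero_add, sub_zero]
        rw [ENNReal.ofReal_add (hr0 x) (by positivity)]
      · simp [hxA, hxB]
  have hδe : ENNReal.ofReal δ = ENNReal.ofReal ε * μ A * (volume B)⁻¹ := by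
    have hB2 : 0 < volume.real B := ENNReal.toReal_pos hB0 hB1
    rw [hδ, ENNReal.ofReal_div_of_pos hB2, ENNReal.ofReal_mul h0, measureReal_def, measureReal_def,
      ENNReal.ofReal_toReal (measure_ne_top _ _), ENNReal.ofReal_toReal hB1, div_eq_mul_inv]
  rw [hsplit, withDensity_add_left (hrm'.indicator hA.compl),
    withDensity_add_left ((hrm'.indicator hA).const_smul _),
    withDensity_smul _ (hrm'.indicator hA), withDensity_indicator hA,
    withDensity_indicator hA.compl, withDensity_indicator hB, withDensity_const,
    ← restrict_withDensity hA, ← restrict_withDensity hA.compl, ← hμ, hδe, redistribute,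
    ProbabilityTheory.cond, smul_smul]

section

variable {X : Set (EuclideanSpace ℝ (Fin m))} (hXo : IsOpen X) (hXb : Bornology.IsBounded X)
  (hXn : X.Nonempty) {a b : ℝ}
  {c : EuclideanSpace ℝ (Fin m) → ℝ → ℝ}
  (hcc : ContinuousOn (fun p : EuclideanSpace ℝ (Fin m) × ℝ => c p.1 p.2)
    (closure X ×ˢ Icc a b)) {M : NNReal}
  (hM : ∀ y ∈ Icc a b, LipschitzOnWith M (fun x => c x y) (closure X))
  {g : ℝ → ℝ} (hg : IsCongestionIntegrand g)
  {ν : Measure ℝ} [IsProbabilityMeasure ν] (hν : ∀ᵐ y ∂ν, y ∈ Icc a b)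
  {μ : Measure (EuclideanSpace ℝ (Fin m))} (hμ : IsMinimizer X c g ν μ)

include hXo hXb hXn hcc hM hg hν hμ

omit hXn in
/-- The first-order condition for moving a little mass from `A` to `B`. -/
theorem first_order_condition {r : EuclideanSpace ℝ (Fin m) → ℝ} (hrm : Measurable r)
    (hr0 : ∀ x, 0 ≤ r x) (hrX : ∀ x ∉ X, r x = 0)
    (hμr : μ = volume.withDensity (fun x => ENNReal.ofReal (r x))) (hri : Integrable r)
    (hgr : IntegrableOn (fun x => g (r x)) X)
    (hG : congestion X g μ = ((∫ x in X, g (r x) : ℝ) : EReal))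
    {A B : Set (EuclideanSpace ℝ (Fin m))} (hA : MeasurableSet A) (hB : MeasurableSet B)
    (hAX : A ⊆ X) (hBX : B ⊆ X) (hAB : Disjoint A B) (hμA : μ A ≠ 0) (hB0 : volume B ≠ 0)
    {ε : ℝ} (h0 : 0 < ε) (h1 : ε < 1) {κA κB : ℝ}
    (hκA : ∀ x ∈ A, 0 < r x ∧ κA + M * ‖x‖ ≤ deriv g ((1 - ε) * r x))
    (hκB : ∀ x ∈ B, deriv g (r x + ε * μ.real A / volume.real B) ≤ κB - M * ‖x‖) :
    κA ≤ κB := by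
  classical
  have hX := hXo.measurableSet
  have hprob := hμ.1.1
  have hB1 : volume B ≠ ⊤ := ne_top_of_le_ne_top hXb.measure_lt_top.ne (measure_mono hBX)
  have hBpos : 0 < volume.real B := ENNReal.toReal_pos hB0 hB1
  have hApos : 0 < μ.real A := ENNReal.toReal_pos hμA (measure_ne_top _ _)
  set δ := ε * μ.real A / volume.real B with hδ
  have hδpos : 0 < δ := by positivity
  set l := ProbabilityTheory.cond volume B with hl
  have hlp : IsProbabilityMeasure l := ProbabilityTheory.cond_isProbabilityMeasure_of_finite hB0 hB1
  have hlX : ∀ᵐ x ∂l, x ∈ closure X := by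
    refine Measure.ae_smul_measure ?_ _
    filter_upwards [ae_restrict_mem hB] with x hx using subset_closure (hBX hx)
  have hμX : ∀ᵐ x ∂μ, x ∈ closure X := mem_ae_iff.2 hμ.1.2
  have hred := redistribute_withDensity hrm hr0 hA hB hAB hB0 hB1 h0.le h1.le hμr
  rw [← hl, ← hδ] at hred
  set h : EuclideanSpace ℝ (Fin m) → ℝ := fun x => r x - A.indicator (fun x => ε * r x) x +
    B.indicator (fun _ => δ) x with hh
  have hhA (x) (hx : x ∈ A) : h x = (1 - ε) * r x := by
    simp only [hh, hx, disjoint_left.1 hAB hx, indicator_of_mem, indicator_of_notMem,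
      not_false_eq_true]
    ring
  have hhB (x) (hx : x ∈ B) : h x = r x + δ := by
    simp [hh, hx, disjoint_right.1 hAB hx]
  have hhE (x) (hxA : x ∉ A) (hxB : x ∉ B) : h x = r x := by simp [hh, hxA, hxB]
  have hhm : Measurable h :=
    (hrm.sub ((hrm.const_mul ε).indicator hA)).add (measurable_const.indicator hB)
  have hh0 (x) : 0 ≤ h x := by
    by_cases hxA : x ∈ A
    · rw [hhA x hxA]; exact mul_nonneg (by linarith) (hr0 x)
    by_cases hxB : x ∈ B
    · rw [hhB x hxB]; linarith [hr0 x]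
    · rw [hhE x hxA hxB]; exact hr0 x
  have hhX (x) (hx : x ∉ X) : h x = 0 := by
    rw [hhE x (fun h => hx (hAX h)) (fun h => hx (hBX h)), hrX x hx]
  have hnX : IntegrableOn (fun x : EuclideanSpace ℝ (Fin m) => M * ‖x‖) X :=
    integrableOn_of_continuous hXb (by fun_prop)
  have hcst (t : ℝ) : IntegrableOn (fun _ : EuclideanSpace ℝ (Fin m) => t) X :=
    integrableOn_of_continuous hXb continuous_const
  have hrn : IntegrableOn (fun x => r x * (M * ‖x‖)) X := by
    obtain ⟨R, hR⟩ := hXb.exists_norm_le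
    refine (hri.integrableOn.mul_const (M * R)).mono' (by fun_prop) ?_
    filter_upwards [ae_restrict_mem hX] with x hx
    rw [Real.norm_of_nonneg (mul_nonneg (hr0 x) (by positivity))]
    have := hr0 x
    gcongr
    exact hR x hx
  -- an integrable upper bound for `g ∘ h`, of which we know the integral
  set P : EuclideanSpace ℝ (Fin m) → ℝ := A.indicator fun x => ε * (r x * κA + r x * (M * ‖x‖))
    with hP
  set Q : EuclideanSpace ℝ (Fin m) → ℝ := B.indicator fun x => δ * (κB - M * ‖x‖) with hQ
  have hPA : IntegrableOn (fun x => r x * κA + r x * (M * ‖x‖)) A :=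
    (hri.integrableOn.mul_const _).add (hrn.mono_set hAX)
  have hQB : IntegrableOn (fun x => κB - M * ‖x‖) B := ((hcst _).sub hnX).mono_set hBX
  have hPi : Integrable P := (integrable_indicator_iff hA).2 (hPA.const_mul _)
  have hQi : Integrable Q := (integrable_indicator_iff hB).2 (hQB.const_mul _)
  -- The tangent is taken at the perturbed value `h x`, since it is `g (h x)` that needs an upper
  -- bound; hence `g'` is evaluated there in `hκA` and `hκB`.
  have hU : ∀ x, g (h x) ≤ g (r x) - P x + Q x := by
    intro x
    by_cases hxA : x ∈ A
    · have hxB := disjoint_left.1 hAB hxA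
      obtain ⟨hrx, hd⟩ := hκA x hxA
      have hp : 0 < (1 - ε) * r x := mul_pos (by linarith) hrx
      have h2 := hg.tangent_le hp (hr0 x)
      have h3 : r x - (1 - ε) * r x = ε * r x := by ring
      rw [h3] at h2
      have h4 := mul_le_mul_of_nonneg_right hd (mul_pos h0 hrx).le
      simp only [hP, hQ, hxA, hxB, indicator_of_mem, indicator_of_notMem, not_false_eq_true]
      rw [hhA x hxA]
      linarith
    by_cases hxB : x ∈ B
    · have hd := hκB x hxB
      have h2 := hg.tangent_le (by linarith [hr0 x] : 0 < r x + δ) (hr0 x)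
      have h4 := mul_le_mul_of_nonneg_right hd hδpos.le
      simp only [hP, hQ, hxA, hxB, indicator_of_mem, indicator_of_notMem, not_false_eq_true]
      rw [hhB x hxB]
      linarith
    · simp [hP, hQ, hxA, hxB, hhE x hxA hxB]
  have hhi : Integrable h :=
    (hri.sub ((integrable_indicator_iff hA).2 (hri.integrableOn.const_mul ε))).add
      ((integrable_indicator_iff hB).2 ((hcst δ).mono_set hBX))
  have hgP : IntegrableOn (fun x => g (r x) - P x) X := hgr.sub hPi.integrableOn
  have hUi : IntegrableOn (fun x => g (r x) - P x + Q x) X := hgP.add hQi.integrableOn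
  -- Without integrability the congestion of the competitor would be `⊤` by definition. The tangent
  -- at 1 bounds `g ∘ h` from below.
  have hgh : IntegrableOn (fun x => g (h x)) X := by
    have hL : IntegrableOn (fun x => g 1 + deriv g 1 * (h x - 1)) X :=
      (hcst _).add ((hhi.integrableOn.sub (hcst 1)).const_mul _)
    refine integrable_of_le_of_le (hg.measurable_comp hhm hh0).aestronglyMeasurable
      (.of_forall fun x => ?_) (.of_forall hU) hL hUi
    exact hg.tangent_le one_pos (hh0 x)
  have hpr : IsProbabilityMeasure (redistribute μ A ε l) :=
    isProbabilityMeasure_redistribute hA h0.le h1.le l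
  have hmin := hμ.2 (redistribute μ A ε l) hpr (by
    have h2 : redistribute μ A ε l ≪ volume.restrict X := by
      rw [hred]; exact withDensity_ofReal_absolutelyContinuous hX hhX
    refine h2 (measure_mono_null (compl_subset_compl.2 subset_closure) ?_)
    rw [Measure.restrict_apply hX.compl, compl_inter_self, measure_empty])
  have hGh : congestion X g (redistribute μ A ε l) = ((∫ x in X, g (h x) : ℝ) : EReal) := by
    rw [hred]
    exact congestion_withDensity hX g hhm hh0 hhX hgh
  rw [hG, hGh, ← EReal.coe_add, ← EReal.coe_add,
    EReal.coe_le_coe_iff] at hmin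
  have hT := transportCost_redistribute_le hXb hcc hμX hν hM hA h0.le h1.le l hlX
  have hGle : ∫ x in X, g (h x) ≤ ∫ x in X, (g (r x) - P x + Q x) :=
    setIntegral_mono hgh hUi hU
  rw [integral_add hgP hQi.integrableOn,
    integral_sub hgr hPi.integrableOn, hP, hQ, setIntegral_indicator hA, setIntegral_indicator hB,
    inter_eq_right.2 hAX, inter_eq_right.2 hBX, integral_const_mul, integral_const_mul,
    integral_add (hri.integrableOn.mul_const _) (hrn.mono_set hAX),
    integral_sub ((hcst _).mono_set hBX) (hnX.mono_set hBX), integral_mul_const,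
    setIntegral_const, smul_eq_mul] at hGle
  have hμint (f : EuclideanSpace ℝ (Fin m) → ℝ) : ∫ x in A, f x ∂μ = ∫ x in A, r x * f x := by
    rw [hμr, setIntegral_withDensity_eq_setIntegral_toReal_smul hrm.ennreal_ofReal
      (.of_forall fun _ => ENNReal.ofReal_lt_top) _ hA]
    simp only [ENNReal.toReal_ofReal (hr0 _), smul_eq_mul]
  have hμA' : ∫ x in A, r x = μ.real A := by
    have := hμint fun _ => 1
    simpa using this.symm
  have hlint : ∫ x, M * ‖x‖ ∂l = (volume.real B)⁻¹ * ∫ x in B, M * ‖x‖ := by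
    rw [hl, ProbabilityTheory.cond, integral_smul_measure, ENNReal.toReal_inv, smul_eq_mul,
      measureReal_def]
  rw [hμint, hlint] at hT
  rw [hμA'] at hGle
  have hδB : δ * (volume.real B * κB - ∫ x in B, M * ‖x‖) =
      ε * (μ.real A * κB - μ.real A * ((volume.real B)⁻¹ * ∫ x in B, M * ‖x‖)) := by
    rw [hδ]; field_simp
  rw [hδB] at hGle
  -- The terms in `M * ‖x‖` from the transport cost and from the congestion cancel exactly.
  have key : ε * (μ.real A * κA) ≤ ε * (μ.real A * κB) := by linarith
  exact le_of_mul_le_mul_left (le_of_mul_le_mul_left key h0) hApos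

/-- The explicit bound on the density of a minimizer. -/
theorem density_le_densityBound {r : EuclideanSpace ℝ (Fin m) → ℝ} (hrm : Measurable r)
    (hr0 : ∀ x, 0 ≤ r x) (hrX : ∀ x ∉ X, r x = 0)
    (hμr : μ = volume.withDensity (fun x => ENNReal.ofReal (r x))) (hri : Integrable r)
    (hgr : IntegrableOn (fun x => g (r x)) X)
    (hG : congestion X g μ = ((∫ x in X, g (r x) : ℝ) : EReal)) :
    volume {x ∈ X | densityBound X g M x < r x} = 0 := by
  have hX := hXo.measurableSet
  have hprob := hμ.1.1
  have hK := hg.massInv_spec hXo hXb hXn M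
  unfold densityBound
  set K := massInv X g (fun z => M * ‖z‖) 1 with hKdef
  set f := derivInv g with hf
  have hfc : Continuous f := hg.continuous_derivInv
  have hfm : StrictMono f := hg.strictMono_derivInv
  by_contra hE
  have hη : Tendsto (fun n : ℕ => 1 / ((n : ℝ) + 1)) atTop (𝓝 0) :=
    tendsto_one_div_add_atTop_nhds_zero_nat
  -- Countable additivity gives a uniform slack `1 / (n + 1)`, both inside `f` and as the fraction
  -- of density that may be removed.
  obtain ⟨n, hn⟩ : ∃ n : ℕ, volume {x ∈ X | f (K + M * ‖x‖ + 1 / ((n : ℝ) + 1)) ≤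
      (1 - 1 / ((n : ℝ) + 1)) * r x} ≠ 0 := by
    by_contra! hall
    refine hE (measure_mono_null ?_ (measure_iUnion_null hall))
    rintro x ⟨hxX, hx⟩
    have h1 : Tendsto (fun n : ℕ => f (K + M * ‖x‖ + 1 / ((n : ℝ) + 1))) atTop
        (𝓝 (f (K + M * ‖x‖))) := by
      have := (hfc.tendsto _).comp (hη.const_add (K + M * ‖x‖))
      rwa [add_zero] at this
    have h2 : Tendsto (fun n : ℕ => (1 - 1 / ((n : ℝ) + 1)) * r x) atTop (𝓝 (r x)) := by
      have := (hη.const_sub 1).mul_const (r x)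
      rwa [sub_zero, one_mul] at this
    obtain ⟨n, hn⟩ := (h1.eventually_lt h2 hx).exists
    exact mem_iUnion.2 ⟨n, hxX, hn.le⟩
  have hηpos : 0 < 1 / ((n : ℝ) + 1) := by positivity
  set η := 1 / ((n : ℝ) + 1) with hηdef
  have hr1 : ∫ x in X, r x = 1 := by
    have h1 : ∫ x in X, r x = ∫ x, r x := setIntegral_eq_integral_of_forall_compl_eq_zero hrX
    have h2 : μ univ = ∫⁻ x, ENNReal.ofReal (r x) := by
      conv_lhs => rw [hμr]
      rw [withDensity_apply _ .univ, Measure.restrict_univ]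
    rw [h1, integral_eq_lintegral_of_nonneg_ae (.of_forall hr0) hrm.aestronglyMeasurable, ← h2]
    simp
  -- Two functions with the same integral over `X` cannot be strictly ordered almost everywhere.
  have hB0 : volume {x ∈ X | r x ≤ f (K - M * ‖x‖)} ≠ 0 := by
    intro h
    have hlt : ∀ᵐ x ∂(volume.restrict X), f (K - M * ‖x‖) < r x := by
      rw [ae_restrict_iff' hX]
      filter_upwards [measure_eq_zero_iff_ae_notMem.1 h] with x hx hxX
      exact not_le.1 fun h' => hx ⟨hxX, h'⟩
    have hfi : IntegrableOn (fun x => f (K - M * ‖x‖)) X :=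
      integrableOn_of_continuous hXb (by fun_prop)
    have h1 : ∫ x in X, (r x - f (K - M * ‖x‖)) = 0 := by
      rw [integral_sub hri.integrableOn hfi, hr1, hK, sub_self]
    rw [integral_eq_zero_iff_of_nonneg_ae (hlt.mono fun x hx => sub_nonneg.2 hx.le)
      (hri.integrableOn.sub hfi)] at h1
    have h2 : ∀ᵐ _ ∂(volume.restrict X), False := by
      filter_upwards [h1, hlt] with x hx hx'
      simp only [Pi.zero_apply] at hx
      linarith
    rw [ae_iff] at h2
    simp only [not_false_eq_true] at h2
    exact (hXo.measure_pos volume hXn).ne' (by simpa using h2)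
  obtain ⟨j, hj⟩ : ∃ j : ℕ, volume {x ∈ X | r x + 1 / ((j : ℝ) + 1) ≤
      f (K - M * ‖x‖ + η / 2)} ≠ 0 := by
    by_contra! hall
    refine hB0 (measure_mono_null ?_ (measure_iUnion_null hall))
    rintro x ⟨hxX, hx⟩
    have h1 : Tendsto (fun n : ℕ => r x + 1 / ((n : ℝ) + 1)) atTop (𝓝 (r x)) := by
      have := hη.const_add (r x)
      rwa [add_zero] at this
    have h2 : r x < f (K - M * ‖x‖ + η / 2) := hx.trans_lt (hfm (by linarith))
    obtain ⟨n, hn⟩ := (h1.eventually_lt tendsto_const_nhds h2).exists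
    exact mem_iUnion.2 ⟨n, hxX, hn.le⟩
  set A := {x ∈ X | f (K + M * ‖x‖ + η) ≤ (1 - η) * r x} with hA
  set B := {x ∈ X | r x + 1 / ((j : ℝ) + 1) ≤ f (K - M * ‖x‖ + η / 2)} with hB
  have hAm : MeasurableSet A :=
    hX.inter (measurableSet_le (f := fun x => f (K + M * ‖x‖ + η)) (g := fun x => (1 - η) * r x)
      (by fun_prop) (by fun_prop))
  have hBm : MeasurableSet B :=
    hX.inter (measurableSet_le (f := fun x => r x + 1 / ((j : ℝ) + 1))
      (g := fun x => f (K - M * ‖x‖ + η / 2)) (by fun_prop) (by fun_prop))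
  have hη1 : η ≤ 1 := by
    rw [hηdef, div_le_one (by positivity)]
    linarith [n.cast_nonneg (α := ℝ)]
  have hArpos : ∀ x ∈ A, 0 < r x := by
    rintro x ⟨-, hx⟩
    have h1 := (hg.derivInv_pos _).trans_le hx
    exact (hr0 x).lt_of_ne fun h => by simp [← h] at h1
  have hAB : Disjoint A B := by
    refine disjoint_left.2 fun x hxA hxB => ?_
    have h1 := hxA.2
    have h2 := hxB.2
    have h3 : (0 : ℝ) ≤ M * ‖x‖ := by positivity
    have h4 : f (K - M * ‖x‖ + η / 2) < f (K + M * ‖x‖ + η) := hfm (by linarith)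
    have h5 : 0 ≤ η * r x := mul_nonneg hηpos.le (hr0 x)
    have h6 : 0 < 1 / ((j : ℝ) + 1) := by positivity
    linarith
  have hB1 : volume B ≠ ⊤ :=
    ne_top_of_le_ne_top hXb.measure_lt_top.ne (measure_mono fun x hx => hx.1)
  have hBpos : 0 < volume.real B := ENNReal.toReal_pos hj hB1
  have hμA : μ A ≠ 0 := by
    rw [hμr, Ne, withDensity_apply_eq_zero hrm.ennreal_ofReal]
    intro h
    refine hn (measure_mono_null (fun x hx => ?_) h)
    exact ⟨(ENNReal.ofReal_pos.2 (hArpos x hx)).ne', hx⟩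
  -- The first bound keeps `1 - ε ≥ 1 - η` on `A`; the second keeps the density added on `B` below
  -- `1 / (j + 1)`.
  have hε : 0 < min (η / 2) (volume.real B * (1 / ((j : ℝ) + 1))) := by positivity
  set ε := min (η / 2) (volume.real B * (1 / ((j : ℝ) + 1))) with hεdef
  have hεη : ε ≤ η / 2 := min_le_left _ _
  -- The conclusion would read `K + η ≤ K + η / 2`.
  have h1 := first_order_condition hXo hXb hcc hM hg hν hμ hrm hr0 hrX hμr hri hgr hG hAm hBm
    (fun x hx => hx.1) (fun x hx => hx.1) hAB hμA hj hε (by linarith) (κA := K + η)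
    (κB := K + η / 2) (fun x hx => ⟨hArpos x hx, ?_⟩) (fun x hx => ?_)
  · linarith
  · rw [add_right_comm]
    refine hg.le_deriv (hx.2.trans ?_)
    have := hr0 x
    gcongr
    linarith
  · have h3 : 0 < ε * μ.real A / volume.real B := by
      have : 0 < μ.real A := ENNReal.toReal_pos hμA (measure_ne_top _ _)
      positivity
    rw [show K + η / 2 - M * ‖x‖ = K - M * ‖x‖ + η / 2 by ring]
    have h4 : ε * μ.real A / volume.real B ≤ 1 / ((j : ℝ) + 1) := by
      rw [div_le_iff₀ hBpos]
      calc ε * μ.real A ≤ ε * 1 := by gcongr; exact measureReal_le_one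
        _ ≤ _ := by rw [mul_one, mul_comm]; exact min_le_right _ _
    exact hg.deriv_le (by linarith [hr0 x]) (le_trans (by linarith) hx.2)

end

/-! ### From masses to nestedness. -/

/-- The supremum is attained because superlevel sets are defined by a weak inequality; the bound `L`
ensures that some level is available. -/
theorem subset_superLevel_kMax {X : Set (EuclideanSpace ℝ (Fin m))}
    {c : EuclideanSpace ℝ (Fin m) → ℝ → ℝ} {y₀ y₁ k₀ L : ℝ}
    (hL : ∀ x ∈ X, |deriv (fun t => c x t) y₁| ≤ L) :
    superLevel X c y₀ k₀ ⊆ superLevel X c y₁ (kMax X c y₀ y₁ k₀) := by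
  intro x hx
  refine ⟨hx.1, csSup_le ⟨-L, fun z hz => ⟨hz.1, (abs_le.1 (hL z hz.1)).1⟩⟩ fun k hk => ?_⟩
  exact (hk hx).2

/-- Nestedness follows once each minimal mass difference is less than the available mass. -/
theorem superLevel_subset_strictSuperLevel {X : Set (EuclideanSpace ℝ (Fin m))}
    {c : EuclideanSpace ℝ (Fin m) → ℝ → ℝ} {y₀ y₁ k₀ k₁ L : ℝ} (hy : y₀ < y₁)
    (hL : ∀ x ∈ X, |deriv (fun t => c x t) y₁| ≤ L)
    (hm₀ : MeasurableSet (superLevel X c y₀ k₀))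
    {μ : Measure (EuclideanSpace ℝ (Fin m))} {ν : Measure ℝ} [IsFiniteMeasure ν]
    (h₀ : IsSplittingLevel X c μ ν y₀ k₀) (h₁ : IsSplittingLevel X c μ ν y₁ k₁)
    (hlt : (superLevel X c y₀ k₀).Nonempty → μ (minRegion X c y₀ y₁ k₀) < ν (Ioc y₀ y₁)) :
    superLevel X c y₀ k₀ ⊆ strictSuperLevel X c y₁ k₁ := by
  intro x hx
  have hsub := subset_superLevel_kMax (k₀ := k₀) (y₀ := y₀) hL
  suffices h : k₁ < kMax X c y₀ y₁ k₀ from ⟨hx.1, h.trans_le (hsub hx).2⟩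
  by_contra! hk
  -- The right side is `ν (Iic y₀)` plus the mass of the minimal region, which is too small to reach
  -- `ν (Iic y₁)`.
  have h2 : μ (superLevel X c y₁ k₁) ≤ μ (superLevel X c y₁ (kMax X c y₀ y₁ k₀)) :=
    measure_mono fun z hz => ⟨hz.1, hk.trans hz.2⟩
  rw [h₁, ← Iic_union_Ioc_eq_Iic hy.le, measure_union (Iic_disjoint_Ioc le_rfl) measurableSet_Ioc,
    ← measure_inter_add_sdiff _ hm₀, inter_eq_right.2 hsub, h₀] at h2
  exact (ENNReal.add_lt_add_left (measure_ne_top ν _) (hlt ⟨x, hx⟩)).not_ge h2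

end Congestion

theorem mainTheorem10 {m : ℕ} (hm : 1 < m)
    (X : Set (EuclideanSpace ℝ (Fin m)))
    (hXo : IsOpen X) (hXb : Bornology.IsBounded X) (hXc : IsConnected X)
    (a b : ℝ) (hab : a < b)
    (c : EuclideanSpace ℝ (Fin m) → ℝ → ℝ)
    (hc : Congestion.IsAdmissibleCost X (Set.Ioo a b) c)
    (M : NNReal)
    (hM : ∀ y ∈ Set.Icc a b, LipschitzOnWith M (fun x => c x y) (closure X))
    (g : ℝ → ℝ) (hg : Congestion.IsCongestionIntegrand g)
    (ν : MeasureTheory.Measure ℝ) (hν : MeasureTheory.IsProbabilityMeasure ν)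
    (νbar : ℝ → ℝ)
    (hνm : AEMeasurable νbar (MeasureTheory.volume.restrict (Set.Ioo a b)))
    (hν0 : ∀ y ∈ Set.Ioo a b, 0 ≤ νbar y)
    (hνd : ν = (MeasureTheory.volume.restrict (Set.Ioo a b)).withDensity
      (fun y => ENNReal.ofReal (νbar y)))
    (μ : MeasureTheory.Measure (EuclideanSpace ℝ (Fin m)))
    (hμ : Congestion.IsMinimizer X c g ν μ)
    (hbound : ∀ y₀ ∈ Set.Ioo a b, ∀ y₁ ∈ Set.Ioo a b, ∀ y, y₀ < y → y < y₁ →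
      ∀ k₀ ∈ (fun x => deriv (fun t => c x t) y₀) '' X,
        Congestion.IsSplittingLevel X c μ ν y₀ k₀ →
        ∀ x ∈ Congestion.minRegion X c y₀ y₁ k₀,
          Congestion.densityBound X g M x <
            νbar y * (y₁ - y₀) /
              Congestion.minMassDiff X c MeasureTheory.volume y₀ y₁ k₀) :
    Congestion.IsNested X (Set.Ioo a b) c μ ν := by
  have hX := hXo.measurableSet
  have hprob := hμ.1.1
  have hcc : ContinuousOn (fun p : EuclideanSpace ℝ (Fin m) × ℝ => c p.1 p.2)
      (closure X ×ˢ Icc a b) := by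
    rw [← closure_Ioo hab.ne]
    exact hc.smooth.continuousOn
  have hνac : ν ≪ volume.restrict (Ioo a b) := by
    rw [hνd]; exact withDensity_absolutelyContinuous _ _
  have hνs : ∀ᵐ y ∂ν, y ∈ Icc a b := hνac.ae_le <| by
    filter_upwards [ae_restrict_mem measurableSet_Ioo] with y hy using Ioo_subset_Icc_self hy
  have hνv : ν ≪ volume := hνac.trans Measure.restrict_le_self.absolutelyContinuous
  have hμac := hμ.absolutelyContinuous hXo hXb hXc.nonempty
  have hμv : μ ≪ volume := hμac.trans Measure.restrict_le_self.absolutelyContinuous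
  have hμX : μ Xᶜ = 0 := hμac (by rw [Measure.restrict_apply hX.compl, compl_inter_self,
    measure_empty])
  obtain ⟨r, hrm, hr0, hrX, hμr, hri, hgr, hG⟩ := hμ.exists_density hXo hXb hXc.nonempty
  have hle := Congestion.density_le_densityBound hXo hXb hXc.nonempty hcc hM hg hνs hμ hrm hr0 hrX
    hμr hri hgr hG
  refine ⟨fun y hy => hc.exists_level hXo hXb hy hμX hμv prob_le_one, ?_⟩
  intro y₀ hy₀ y₁ hy₁ hy hpos k₀ k₁ h₀ h₁
  obtain ⟨L, hL⟩ := hc.exists_abs_deriv_le hXo hXb hy₁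
  have hm₀ := hc.measurableSet_superLevel hXo hy₀ k₀
  have hνIoc : ν (Ioc y₀ y₁) = ν (Icc y₀ y₁) :=
    measure_congr (hνv.ae_eq Ioc_ae_eq_Icc)
  refine Congestion.superLevel_subset_strictSuperLevel hy hL hm₀ h₀ h₁ fun hne => ?_
  rw [hνIoc]
  set S := Congestion.minRegion X c y₀ y₁ k₀ with hS
  have hSX : S ⊆ X := fun x hx => hx.1.1
  have hSm : MeasurableSet S := (hc.measurableSet_superLevel hXo hy₁ _).diff hm₀
  -- the level `k₀` is attained
  have hk₀ : k₀ ∈ (fun x => deriv (fun t => c x t) y₀) '' X := by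
    obtain ⟨x, hxX, hx⟩ := hne
    by_contra hnot
    -- If `k₀` is not attained, connectedness puts all of `X` above it, and no mass of `ν` is left
    -- for `(y₀, y₁]`.
    have hall : Congestion.superLevel X c y₀ k₀ = X := by
      refine Subset.antisymm (fun z hz => hz.1) fun z hz => ⟨hz, ?_⟩
      by_contra! hlt
      exact hnot (hXc.isPreconnected.intermediate_value hz hxX
        (hc.continuousOn_deriv hXo hy₀) ⟨hlt.le, hx⟩)
    have h1 : μ X = 1 := by
      rw [← prob_compl_eq_zero_iff hX]; exact hμX
    have h2 : ν (Iic y₀) = 1 := by rw [← h₀, hall, h1]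
    have h3 : ν (Ioc y₀ y₁) = 0 :=
      measure_mono_null (fun z hz => not_le.2 hz.1) ((prob_compl_eq_zero_iff measurableSet_Iic).2 h2)
    rw [← hνIoc, h3] at hpos
    exact hpos.false
  rcases eq_or_ne (volume S) 0 with hS0 | hS0
  · rwa [hμv hS0]
  have hSt : volume S ≠ ⊤ := ne_top_of_le_ne_top hXb.measure_lt_top.ne (measure_mono hSX)
  have hD : 0 < Congestion.minMassDiff X c volume y₀ y₁ k₀ := ENNReal.toReal_pos hS0 hSt
  set D := Congestion.minMassDiff X c volume y₀ y₁ k₀ with hDdef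
  have hΔ : 0 < y₁ - y₀ := sub_pos.2 hy
  -- the mass of `S` is less than `νbar y * (y₁ - y₀)` for every `y` in between
  have hmass : ∀ y ∈ Ioo y₀ y₁, μ S / ENNReal.ofReal (y₁ - y₀) < ENNReal.ofReal (νbar y) := by
    intro y hyI
    have hb := hbound y₀ hy₀ y₁ hy₁ y hyI.1 hyI.2 k₀ hk₀ h₀
    rw [ENNReal.div_lt_iff (.inl (by simpa using hy)) (.inl ENNReal.ofReal_ne_top),
      ← ENNReal.ofReal_mul (hν0 y ⟨hy₀.1.trans hyI.1, hyI.2.trans hy₁.2⟩)]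
    set q := νbar y * (y₁ - y₀) with hq
    -- Spreading `q` evenly over `S` gives the density `q / D`, which exceeds `r` almost everywhere
    -- on `S`.
    have hqD : ENNReal.ofReal q = ∫⁻ _ in S, ENNReal.ofReal (q / D) := by
      rw [setLIntegral_const, ← ENNReal.ofReal_toReal hSt,
        ← ENNReal.ofReal_mul' ENNReal.toReal_nonneg]
      congr 1
      exact (div_mul_cancel₀ q hD.ne').symm
    have hμS : μ S = ∫⁻ x in S, ENNReal.ofReal (r x) := by
      conv_lhs => rw [hμr]
      exact withDensity_apply _ hSm
    rw [hμS, hqD]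
    refine setLIntegral_strict_mono hSm hS0 (by fun_prop) ?_ ?_
    · rw [← hμS]; exact measure_ne_top _ _
    · filter_upwards [measure_eq_zero_iff_ae_notMem.1 hle] with x hx hxS
      have h1 : r x ≤ Congestion.densityBound X g M x := not_lt.1 fun h => hx ⟨hSX hxS, h⟩
      have h2 := hb x hxS
      exact (ENNReal.ofReal_lt_ofReal_iff ((hg.derivInv_pos _).trans h2)).2 (h1.trans_lt h2)
  have hIsub : Ioo y₀ y₁ ⊆ Ioo a b := Ioo_subset_Ioo hy₀.1.le hy₁.2.le
  have hνI : ν (Icc y₀ y₁) = ∫⁻ y in Ioo y₀ y₁, ENNReal.ofReal (νbar y) := by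
    rw [← measure_congr (hνv.ae_eq (Ioo_ae_eq_Icc (a := y₀) (b := y₁))), hνd,
      withDensity_apply _ measurableSet_Ioo, Measure.restrict_restrict measurableSet_Ioo,
      inter_eq_left.2 hIsub]
  -- Written as the integral of a constant over `(y₀, y₁)`, the mass of `S` can be compared
  -- pointwise with `νbar`.
  have hconst : μ S = ∫⁻ _ in Ioo y₀ y₁, μ S / ENNReal.ofReal (y₁ - y₀) := by
    rw [setLIntegral_const, Real.volume_Ioo, ENNReal.div_mul_cancel (by simpa using hy)
      ENNReal.ofReal_ne_top]
  have hνm' : AEMeasurable (fun y => ENNReal.ofReal (νbar y)) (volume.restrict (Ioo y₀ y₁)) :=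
    (hνm.mono_measure (Measure.restrict_mono hIsub le_rfl)).ennreal_ofReal
  rw [hνI, hconst]
  refine lintegral_strict_mono ?_ hνm' ?_ ?_
  · rw [Ne, Measure.restrict_eq_zero, Real.volume_Ioo]
    simpa using hy
  · rw [← hconst]; exact measure_ne_top _ _
  · filter_upwards [ae_restrict_mem measurableSet_Ioo] with y hyI using hmass y hyI
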